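/- **Setting.** Let $W=D_4^{\oplus 4}\oplus A_1^{\oplus 2}\oplus\langle-4\rangle\oplus\langle4\rangle\oplus\langle2\rangle\oplus\langle2\rangle$, where $D_4$, $A_1$ are negative definite. The four copies of $D_4$ have bases $(e_i),(f_i),(g_i),(h_i)$, $1\le i\le 4$, of vectors of square $-2$, in which the third vector has product $1$ with each of the other three and all other products vanish; $a_1,a_2$ generate the copies of $A_1$, and $\sigma,\rho,\omega_1,\omega_2$ generate $\langle-4\rangle,\langle4\rangle,\langle2\rangle,\langle2\rangle$. The K3 lattice $\Lambda_{\mathrm{K3}}$ is the overlattice of $W$ generated by $W$ and $$\begin{aligned} \chi&=\tfrac{\rho+\sigma}{2}, & \alpha&=\tfrac{\rho+\sigma}{4}+\tfrac{e_1+e_2+f_1+f_4}{2}, & \beta&=\tfrac{\rho-\sigma}{4}+\tfrac{f_1+f_2+g_1+g_4}{2},\\ \gamma&=\tfrac{\rho+\sigma}{4}+\tfrac{g_1+g_2+h_1+h_4}{2}, & \delta&=\tfrac{\rho-\sigma}{4}+\tfrac{h_1+h_2+e_1+e_4}{2}, & \varepsilon&=\tfrac{\rho+f_2+f_4+h_2+h_4+a_1+a_2}{2},\\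 \zeta&=\tfrac{e_1+f_1+e_4+f_2+a_1+\omega_1}{2}, & \eta&=\tfrac{e_1+f_1+e_4+f_2+a_2+\omega_2}{2}. \end{aligned}$$ The isometry $\tau^*$ of $\Lambda_{\mathrm{K3}}$ induced by a symplectic automorphism of order $4$ of a K3 surface is given by $e_i\mapsto f_i\mapsto g_i\mapsto h_i\mapsto e_i$, $a_1\leftrightarrow a_2$, $\sigma\mapsto-\sigma$, and it fixes $\rho,\omega_1,\omega_2$. Let $\Omega_4$ be the orthogonal complement in $\Lambda_{\mathrm{K3}}$ of the sublattice of $\tau^*$-invariant elements. For an even lattice $S$ with form $b$ let $S^*=\{x\in S\otimes\mathbb Q: b(x,s)\in\mathbb Z\ \forall s\in S\}$, let $A_S=S^*/S$ be its discriminant group and $q_S:A_S\to\mathbb Q/2\mathbb Z$, $q_S(x+S)=b(x,x)+2\mathbb Z$, its discriminant form; $O(S)$, the group of isometries of $S$, acts on $A_S$. For $r,s\in A_S$ write $r\sim_S s$ if $r$ and $s$ have the same order and $q_S(r)=q_S(s)$, and $r\approx_S s$ if some element of $O(S)$ sends $r$ to $s$. Denote by $(k,g)$ the set of elements of $A_S$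 of order $k$ with $q_S=g$. **Theorem.** $A_{\Omega_4}\simeq(\mathbb Z/4\mathbb Z)^4\times(\mathbb Z/2\mathbb Z)^2$. The relation $\sim_{\Omega_4}$ has exactly eight classes: the trivial class $\{0\}$ and the seven classes $(2,0)$, $(2,\frac12)$, $(2,1)$, $(4,0)$, $(4,\frac12)$, $(4,1)$, $(4,\frac32)$, with cardinalities $$\begin{array}{c|cccc} k\backslash g&0&1/2&1&3/2\\ \hline 2&15&32&16&0\\ 4&240&240&240&240\end{array}$$ (in particular $(2,\frac32)$ is empty). Each of the seven classes is a single class for $\approx_{\Omega_4}$, except for $(2,1)$, which is the disjoint union of two classes for $\approx_{\Omega_4}$, one, $(2,1,6)$, with $6$ elements and the other, $(2,1,10)$, with $10$ elements. The following elements of $\Omega_4^*$ represent the non-trivial classes for $\approx_{\Omega_4}$ (the last entry is the cardinality): $$\begin{array}{c|c} (2,0,15)& \frac{3e_3-f_3-g_3-h_3}{2}\\[4pt] (2,\frac12,32)& \frac{2e_1-f_1-g_1+e_4-f_4+\alpha-\gamma+\sigma+(e_2-g_2+e_4-g_4+a_1-a_2+\sigma)/2}{2}\\[4pt] (2,1,6)&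 \frac{\sigma}{2}\\[4pt] (2,1,10)& \frac{\sigma+3e_3-f_3-g_3-h_3}{2}\\[4pt] (4,0,240)& \frac{3(3e_3-f_3-g_3-h_3)+2(2e_1-f_1-g_1+e_4-f_4+\alpha-\gamma)+e_2-g_2+e_4-g_4+a_1-a_2+\sigma}{4}\\[4pt] (4,\frac12,240)& \frac{3(3e_1-f_1-g_1-h_1)}{4}\\[4pt] (4,1,240)& \frac{3(3e_1-f_1-g_1-h_1+3\alpha-\beta-\gamma-\delta)+2(e_2-g_2+e_4-g_4+\sigma)}{4}\\[4pt] (4,\frac32,240)& \frac{2(e_1-g_1+e_2-g_2)+a_1-a_2+\sigma}{4} \end{array}$$ -/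

import Mathlib

/-! ## Even lattices, discriminant groups and isometries -/

/-- An even lattice realised inside a rational vector space `V`: a finitely generated
subgroup `S` of `V` (hence free of finite rank) with a symmetric bilinear form which is
even and nondegenerate on `S`. -/
structure EvenLattice (V : Type*) [AddCommGroup V] [Module ℚ V] where
  form : LinearMap.BilinForm ℚ V
  carrier : Submodule ℤ V
  fg : carrier.FG
  symm : form.IsSymm
  even : ∀ x ∈ carrier, ∃ n : ℤ, form x x = 2 * n
  nondegenerate : ∀ x ∈ carrier, (∀ y ∈ carrier, form x y = 0) → x = 0

namespace EvenLattice

variable {V : Type*} [AddCommGroup V] [Module ℚ V] (S : EvenLattice V)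

theorem integral {x y : V} (hx : x ∈ S.carrier) (hy : y ∈ S.carrier) :
    ∃ n : ℤ, S.form x y = n := by
  obtain ⟨a, ha⟩ := S.even x hx
  obtain ⟨b, hb⟩ := S.even y hy
  obtain ⟨c, hc⟩ := S.even (x + y) (add_mem hx hy)
  refine ⟨c - a - b, ?_⟩
  have h := S.symm.eq y x
  simp only [map_add, LinearMap.add_apply] at hc
  push_cast
  linarith

/-- `S ⊗ ℚ`, realised as the rational span of `S`. -/
abbrev ratSpan : Submodule ℚ V := Submodule.span ℚ (S.carrier : Set V)

/-- The inclusion `S → S ⊗ ℚ`. -/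
def incl : S.carrier →ₗ[ℤ] S.ratSpan where
  toFun s := ⟨s, Submodule.subset_span s.2⟩
  map_add' _ _ := rfl
  map_smul' _ _ := rfl

/-- The dual lattice `S* = {x ∈ S ⊗ ℚ | b(x, s) ∈ ℤ for all s ∈ S}`. -/
def dual : Submodule ℤ V where
  carrier := {x | x ∈ S.ratSpan ∧ ∀ s ∈ S.carrier, ∃ n : ℤ, S.form x s = n}
  zero_mem' := ⟨zero_mem _, fun s _ => ⟨0, by simp⟩⟩
  add_mem' := by
    rintro x y ⟨hx, hx'⟩ ⟨hy, hy'⟩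
    refine ⟨add_mem hx hy, fun s hs => ?_⟩
    obtain ⟨a, ha⟩ := hx' s hs
    obtain ⟨b, hb⟩ := hy' s hs
    exact ⟨a + b, by simp [ha, hb]⟩
  smul_mem' := by
    rintro c x ⟨hx, hx'⟩
    refine ⟨zsmul_mem hx c, fun s hs => ?_⟩
    obtain ⟨a, ha⟩ := hx' s hs
    exact ⟨c * a, by simp [ha]⟩

theorem carrier_le_dual : S.carrier ≤ S.dual :=
  fun _ hx => ⟨Submodule.subset_span hx, fun _ hs => S.integral hx hs⟩

/-- The discriminant group `A_S = S* / S`. -/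
abbrev discGroup : Type _ := S.dual ⧸ S.carrier.submoduleOf S.dual

/-- The class in `A_S` of an element of `S*`. -/
def toDisc (x : V) (hx : x ∈ S.dual) : S.discGroup := Submodule.Quotient.mk ⟨x, hx⟩

/-- The discriminant form `q_S : A_S → ℚ / 2ℤ`, `x + S ↦ b(x, x) + 2ℤ`. -/
def discForm (r : S.discGroup) : AddCircle (2 : ℚ) :=
  Quotient.liftOn' r (fun x => ((S.form x x : ℚ) : AddCircle (2 : ℚ))) (by
    intro x y hxy
    have hs : (x : V) - y ∈ S.carrier :=
      (Submodule.quotientRel_def (S.carrier.submoduleOf S.dual)).1 hxy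
    obtain ⟨n, hn⟩ := S.even _ hs
    obtain ⟨k, hk⟩ := y.2.2 _ hs
    have hsymm := S.symm.eq (y : V) x
    simp only [map_sub, LinearMap.sub_apply] at hn hk
    have h : S.form x x - S.form y y = 2 * ((n + k : ℤ) : ℚ) := by
      push_cast
      linarith
    rw [← sub_eq_zero, ← AddCircle.coe_sub, AddCircle.coe_eq_zero_iff]
    exact ⟨n + k, by rw [h, zsmul_eq_mul, mul_comm]⟩)

/-- The group `O(S)` of isometries of `S`. -/
def isometryGroup : Subgroup (S.carrier ≃ₗ[ℤ] S.carrier) where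
  carrier := {φ | ∀ x y : S.carrier, S.form (φ x) (φ y) = S.form x y}
  one_mem' _ _ := rfl
  mul_mem' {φ ψ} hφ hψ x y := (hφ (ψ x) (ψ y)).trans (hψ x y)
  inv_mem' {φ} hφ x y := by
    rw [← hφ]
    simp

/-! ### The action of `O(S)` on the discriminant group -/

theorem exists_smul_mem (x : S.ratSpan) : ∃ n : ℤ, n ≠ 0 ∧ ∃ s : S.carrier, n • x = S.incl s := by
  obtain ⟨x, hx⟩ := x
  induction hx using Submodule.span_induction with
  | mem x h => exact ⟨1, one_ne_zero, ⟨x, h⟩, by ext; simp [incl]⟩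
  | zero => exact ⟨1, one_ne_zero, 0, by ext; simp [incl]⟩
  | add x y hx hy ihx ihy =>
    obtain ⟨n, hn, s, hs⟩ := ihx
    obtain ⟨m, hm, t, ht⟩ := ihy
    refine ⟨n * m, mul_ne_zero hn hm, m • s + n • t, ?_⟩
    rw [map_add, map_zsmul, map_zsmul, ← hs, ← ht]
    ext
    simp only [Submodule.coe_add, Submodule.coe_smul_of_tower]
    module
  | smul a x hx ih =>
    obtain ⟨n, hn, s, hs⟩ := ih
    refine ⟨n * a.den, mul_ne_zero hn (by exact_mod_cast a.den_ne_zero), a.num • s, ?_⟩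
    rw [map_zsmul, ← hs]
    ext
    simp only [Submodule.coe_smul_of_tower]
    rw [← Int.cast_smul_eq_zsmul ℚ, ← Int.cast_smul_eq_zsmul ℚ a.num,
      ← Int.cast_smul_eq_zsmul ℚ n, smul_smul, smul_smul]
    congr 1
    push_cast
    rw [mul_assoc, Rat.den_mul_eq_num, mul_comm]

instance isLocalizedModule_incl : IsLocalizedModule (nonZeroDivisors ℤ) S.incl where
  map_units n := by
    have hn : ((n : ℤ) : ℚ) ≠ 0 := by exact_mod_cast nonZeroDivisors.coe_ne_zero n
    rw [Module.End.isUnit_iff]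
    refine ⟨fun x y h => ?_, fun y => ⟨((n : ℤ) : ℚ)⁻¹ • y, ?_⟩⟩
    · simp only [Module.algebraMap_end_apply, ← Int.cast_smul_eq_zsmul ℚ] at h
      exact smul_right_injective _ hn h
    · simp only [Module.algebraMap_end_apply, ← Int.cast_smul_eq_zsmul ℚ]
      rw [smul_smul, mul_inv_cancel₀ hn, one_smul]
  surj x := by
    obtain ⟨n, hn, s, hs⟩ := S.exists_smul_mem x
    exact ⟨(s, ⟨n, mem_nonZeroDivisors_of_ne_zero hn⟩), hs⟩
  exists_of_eq {x y} h := ⟨1, congrArg _ (Subtype.ext (congrArg (fun z : S.ratSpan => (z : V)) h))⟩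

/-- The `ℚ`-linear extension to `S ⊗ ℚ` of an endomorphism of `S`. -/
noncomputable def ratExt (φ : S.carrier →ₗ[ℤ] S.carrier) : S.ratSpan →ₗ[ℚ] S.ratSpan :=
  IsLocalizedModule.mapExtendScalars (nonZeroDivisors ℤ) S.incl S.incl ℚ φ

theorem ratExt_incl (φ : S.carrier →ₗ[ℤ] S.carrier) (s : S.carrier) :
    S.ratExt φ (S.incl s) = S.incl (φ s) :=
  IsLocalizedModule.map_apply (nonZeroDivisors ℤ) S.incl S.incl φ s

/-- A `ℚ`-linear map out of `S ⊗ ℚ` is determined by its values on `S`. -/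
theorem ratSpan_ext {f g : S.ratSpan →ₗ[ℚ] S.ratSpan}
    (h : ∀ s : S.carrier, f (S.incl s) = g (S.incl s)) : f = g := by
  ext1 x
  obtain ⟨n, hn, s, hs⟩ := S.exists_smul_mem x
  have := h s
  rw [← hs, map_zsmul, map_zsmul] at this
  rw [← Int.cast_smul_eq_zsmul ℚ, ← Int.cast_smul_eq_zsmul ℚ] at this
  exact smul_right_injective _ (Int.cast_ne_zero.2 hn) this

theorem ratExt_id : S.ratExt LinearMap.id = LinearMap.id :=
  S.ratSpan_ext fun s => by rw [ratExt_incl]; rfl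

theorem ratExt_comp (φ ψ : S.carrier →ₗ[ℤ] S.carrier) :
    S.ratExt (φ ∘ₗ ψ) = S.ratExt φ ∘ₗ S.ratExt ψ :=
  S.ratSpan_ext fun s => by simp [ratExt_incl]

theorem form_ratExt (φ : S.isometryGroup) (x : S.ratSpan) (s : S.carrier) :
    S.form (S.ratExt φ.1 x) (φ.1 s) = S.form x s := by
  obtain ⟨n, hn, t, ht⟩ := S.exists_smul_mem x
  have h : n • S.ratExt φ.1 x = S.incl (φ.1 t) := by
    rw [← map_zsmul, ht, ratExt_incl]; rfl
  have h1 := φ.2 t s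
  have h2 : (n : ℚ) * S.form (S.ratExt φ.1 x) (φ.1 s) = S.form (φ.1 t) (φ.1 s) := by
    have := congrArg (fun z : S.ratSpan => S.form z (φ.1 s)) h
    simpa [incl] using this
  have h3 : (n : ℚ) * S.form x s = S.form t s := by
    have := congrArg (fun z : S.ratSpan => S.form z s) ht
    simpa [incl] using this
  exact mul_left_cancel₀ (Int.cast_ne_zero.2 hn) (by rw [h2, h3, h1])

/-- The isometry of `S*` obtained from an isometry of `S` by `ℚ`-linear extension. -/
noncomputable def dualMap (φ : S.isometryGroup) : S.dual →ₗ[ℤ] S.dual where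
  toFun x := ⟨S.ratExt φ.1 ⟨x, x.2.1⟩, (S.ratExt φ.1 ⟨x, x.2.1⟩).2, fun s hs => by
    obtain ⟨t, ht⟩ := φ.1.surjective ⟨s, hs⟩
    obtain ⟨n, hn⟩ := x.2.2 t t.2
    refine ⟨n, ?_⟩
    rw [← hn, ← S.form_ratExt φ ⟨x, x.2.1⟩ t, ht]⟩
  map_add' x y := Subtype.ext (congrArg (fun z : S.ratSpan => (z : V))
    (map_add (S.ratExt φ.1) ⟨x, x.2.1⟩ ⟨y, y.2.1⟩))
  map_smul' c x := Subtype.ext ((congrArg (fun z : S.ratSpan => (z : V))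
    (map_zsmul (S.ratExt φ.1) c ⟨x, x.2.1⟩)).trans (Submodule.coe_smul_of_tower _ _))

theorem coe_dualMap (φ : S.isometryGroup) (x : S.dual) :
    (S.dualMap φ x : V) = S.ratExt φ.1 ⟨x, x.2.1⟩ := rfl

/-- The automorphism of `A_S` induced by an isometry of `S`. -/
noncomputable def discMap (φ : S.isometryGroup) : S.discGroup →ₗ[ℤ] S.discGroup :=
  Submodule.mapQ _ _ (S.dualMap φ) (by
    intro x hx
    have h : (⟨x, x.2.1⟩ : S.ratSpan) = S.incl ⟨x, hx⟩ := rfl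
    change ((S.ratExt φ.1 ⟨x, x.2.1⟩ : S.ratSpan) : V) ∈ S.carrier
    rw [h, ratExt_incl]
    exact (φ.1 ⟨x, hx⟩).2)

theorem discMap_one : S.discMap 1 = LinearMap.id := by
  ext x
  refine congrArg (Submodule.Quotient.mk (p := S.carrier.submoduleOf S.dual)) (Subtype.ext ?_)
  exact congrArg (fun z : S.ratSpan => (z : V)) (LinearMap.congr_fun S.ratExt_id ⟨x, x.2.1⟩)

theorem discMap_mul (φ ψ : S.isometryGroup) :
    S.discMap (φ * ψ) = S.discMap φ ∘ₗ S.discMap ψ := by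
  ext x
  refine congrArg (Submodule.Quotient.mk (p := S.carrier.submoduleOf S.dual)) (Subtype.ext ?_)
  exact congrArg (fun z : S.ratSpan => (z : V)) (LinearMap.congr_fun (S.ratExt_comp φ.1 ψ.1) ⟨x, x.2.1⟩)

/-! ### The two equivalence relations on the discriminant group -/

/-- The relation `r ∼_S s`: same order and same square. -/
def orderSquareRel : Setoid S.discGroup where
  r r s := addOrderOf r = addOrderOf s ∧ S.discForm r = S.discForm s
  iseqv := ⟨fun _ => ⟨rfl, rfl⟩, fun h => ⟨h.1.symm, h.2.symm⟩,
    fun h h' => ⟨h.1.trans h'.1, h.2.trans h'.2⟩⟩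

/-- The relation `r ≈_S s`: some isometry of `S` induces a map of `A_S` that sends `r` to `s`. -/
def isometryRel : Setoid S.discGroup where
  r r s := ∃ φ : S.isometryGroup, S.discMap φ r = s
  iseqv := by
    refine ⟨fun r => ⟨1, by rw [discMap_one]; rfl⟩, ?_, ?_⟩
    · rintro r _ ⟨φ, rfl⟩
      refine ⟨φ⁻¹, ?_⟩
      rw [← LinearMap.comp_apply, ← discMap_mul, inv_mul_cancel, discMap_one]
      rfl
    · rintro r _ _ ⟨φ, rfl⟩ ⟨ψ, rfl⟩
      exact ⟨ψ * φ, by rw [discMap_mul]; rfl⟩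

/-- The set `(k, g)` of the elements of `A_S` of order `k` and square `g`. -/
def orderSquareClass (k : ℕ) (g : ℚ) : Set S.discGroup :=
  {r | addOrderOf r = k ∧ S.discForm r = (g : AddCircle (2 : ℚ))}

/-- The orbit of `r ∈ A_S` under `O(S)`, that is, its class for `≈_S`. -/
def isometryClass (r : S.discGroup) : Set S.discGroup :=
  {s | S.isometryRel r s}

end EvenLattice

/-! ## The K3 lattice with the isometry induced by a symplectic automorphism of order 4 -/

namespace K3

/-- The rational vector space with basis `e₁, …, e₄, f₁, …, f₄, g₁, …, g₄, h₁, …, h₄, a₁, a₂,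
σ, ρ, ω₁, ω₂`. -/
abbrev Space : Type := Fin 22 → ℚ

def e₁ : Space := Pi.single 0 1
def e₂ : Space := Pi.single 1 1
def e₃ : Space := Pi.single 2 1
def e₄ : Space := Pi.single 3 1
def f₁ : Space := Pi.single 4 1
def f₂ : Space := Pi.single 5 1
def f₃ : Space := Pi.single 6 1
def f₄ : Space := Pi.single 7 1
def g₁ : Space := Pi.single 8 1
def g₂ : Space := Pi.single 9 1
def g₃ : Space := Pi.single 10 1
def g₄ : Space := Pi.single 11 1
def h₁ : Space := Pi.single 12 1
def h₂ : Space := Pi.single 13 1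
def h₃ : Space := Pi.single 14 1
def h₄ : Space := Pi.single 15 1
def a₁ : Space := Pi.single 16 1
def a₂ : Space := Pi.single 17 1
def σ : Space := Pi.single 18 1
def ρ : Space := Pi.single 19 1
def ω₁ : Space := Pi.single 20 1
def ω₂ : Space := Pi.single 21 1

/-- The form of the negative definite lattice `D₄`, with basis vectors of square `-2`, the third
one meeting each of the other three once. -/
def d4 (u v : Fin 4 → ℚ) : ℚ :=
  -2 * (u 0 * v 0 + u 1 * v 1 + u 2 * v 2 + u 3 * v 3)
    + u 2 * (v 0 + v 1 + v 3) + (u 0 + u 1 + u 3) * v 2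

/-- The form of `W = D₄^{⊕4} ⊕ A₁^{⊕2} ⊕ ⟨-4⟩ ⊕ ⟨4⟩ ⊕ ⟨2⟩ ⊕ ⟨2⟩`, extended to `W ⊗ ℚ`. -/
def form : LinearMap.BilinForm ℚ Space :=
  LinearMap.mk₂ ℚ (fun x y =>
      d4 ![x 0, x 1, x 2, x 3] ![y 0, y 1, y 2, y 3]
      + d4 ![x 4, x 5, x 6, x 7] ![y 4, y 5, y 6, y 7]
      + d4 ![x 8, x 9, x 10, x 11] ![y 8, y 9, y 10, y 11]
      + d4 ![x 12, x 13, x 14, x 15] ![y 12, y 13, y 14, y 15]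
      - 2 * (x 16 * y 16) - 2 * (x 17 * y 17)
      - 4 * (x 18 * y 18) + 4 * (x 19 * y 19) + 2 * (x 20 * y 20) + 2 * (x 21 * y 21))
    (fun x x' y => by simp [d4]; ring) (fun c x y => by simp [d4]; ring)
    (fun x y y' => by simp [d4]; ring) (fun c x y => by simp [d4]; ring)

def χ : Space := (1 / 2 : ℚ) • (ρ + σ)
def α : Space := (1 / 4 : ℚ) • (ρ + σ) + (1 / 2 : ℚ) • (e₁ + e₂ + f₁ + f₄)
def β : Space := (1 / 4 : ℚ) • (ρ - σ) + (1 / 2 : ℚ) • (f₁ + f₂ + g₁ + g₄)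
def γ : Space := (1 / 4 : ℚ) • (ρ + σ) + (1 / 2 : ℚ) • (g₁ + g₂ + h₁ + h₄)
def δ : Space := (1 / 4 : ℚ) • (ρ - σ) + (1 / 2 : ℚ) • (h₁ + h₂ + e₁ + e₄)
def ε : Space := (1 / 2 : ℚ) • (ρ + f₂ + f₄ + h₂ + h₄ + a₁ + a₂)
def ζ : Space := (1 / 2 : ℚ) • (e₁ + f₁ + e₄ + f₂ + a₁ + ω₁)
def η : Space := (1 / 2 : ℚ) • (e₁ + f₁ + e₄ + f₂ + a₂ + ω₂)

/-- Generators of the K3 lattice: a basis of `W` and eight glue vectors. -/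
def generators : Fin 30 → Space :=
  ![e₁, e₂, e₃, e₄, f₁, f₂, f₃, f₄, g₁, g₂, g₃, g₄, h₁, h₂, h₃, h₄, a₁, a₂, σ, ρ, ω₁, ω₂,
    χ, α, β, γ, δ, ε, ζ, η]

theorem glue_coordinates :
    χ = ![0, 0, 0, 0, 0, 0, 0, 0, 0, 0, 0, 0, 0, 0, 0, 0, 0, 0, 1/2, 1/2, 0, 0] ∧
    α = ![1/2, 1/2, 0, 0, 1/2, 0, 0, 1/2, 0, 0, 0, 0, 0, 0, 0, 0, 0, 0, 1/4, 1/4, 0, 0] ∧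
    β = ![0, 0, 0, 0, 1/2, 1/2, 0, 0, 1/2, 0, 0, 1/2, 0, 0, 0, 0, 0, 0, -1/4, 1/4, 0, 0] ∧
    γ = ![0, 0, 0, 0, 0, 0, 0, 0, 1/2, 1/2, 0, 0, 1/2, 0, 0, 1/2, 0, 0, 1/4, 1/4, 0, 0] ∧
    δ = ![1/2, 0, 0, 1/2, 0, 0, 0, 0, 0, 0, 0, 0, 1/2, 1/2, 0, 0, 0, 0, -1/4, 1/4, 0, 0] ∧
    ε = ![0, 0, 0, 0, 0, 1/2, 0, 1/2, 0, 0, 0, 0, 0, 1/2, 0, 1/2, 1/2, 1/2, 0, 1/2, 0, 0] ∧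
    ζ = ![1/2, 0, 0, 1/2, 1/2, 1/2, 0, 0, 0, 0, 0, 0, 0, 0, 0, 0, 1/2, 0, 0, 0, 1/2, 0] ∧
    η = ![1/2, 0, 0, 1/2, 1/2, 1/2, 0, 0, 0, 0, 0, 0, 0, 0, 0, 0, 0, 1/2, 0, 0, 0, 1/2] := by
  decide +kernel

theorem coordinates (c : Fin 30 → ℤ) (k : Fin 22) : (∑ m, c m • generators m) k =
    c (k.castLE (by norm_num)) + c 22 * χ k + c 23 * α k + c 24 * β k + c 25 * γ k
      + c 26 * δ k + c 27 * ε k + c 28 * ζ k + c 29 * η k := by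
  have h : ∑ m : Fin 30, c m • generators m = (fun k : Fin 22 => (c (k.castLE (by norm_num)) : ℚ))
      + c 22 • χ + c 23 • α + c 24 • β + c 25 • γ + c 26 • δ + c 27 • ε + c 28 • ζ + c 29 • η := by
    rw [Fin.sum_univ_castSucc, Fin.sum_univ_castSucc, Fin.sum_univ_castSucc,
      Fin.sum_univ_castSucc, Fin.sum_univ_castSucc, Fin.sum_univ_castSucc,
      Fin.sum_univ_castSucc, Fin.sum_univ_castSucc]
    refine congrArg₂ _ (congrArg₂ _ (congrArg₂ _ (congrArg₂ _ (congrArg₂ _ (congrArg₂ _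
      (congrArg₂ _ (congrArg₂ _ ?_ rfl) rfl) rfl) rfl) rfl) rfl) rfl) rfl
    have h1 : ∀ m : Fin 22, generators (m.castLE (by norm_num)) = Pi.single m 1 := fun m => by
      fin_cases m <;> rfl
    rw [← (Pi.basisFun ℚ (Fin 22)).sum_repr
      (fun k : Fin 22 => (c (k.castLE (by norm_num)) : ℚ))]
    refine Finset.sum_congr rfl fun m _ => ?_
    rw [Pi.basisFun_apply, Pi.basisFun_repr, Int.cast_smul_eq_zsmul]
    exact congrArg _ (h1 m)
  rw [h]
  simp

theorem form_symm : form.IsSymm :=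
  ⟨fun x y => by simp only [form, LinearMap.mk₂_apply, d4]; simp; ring⟩

theorem form_even {x : Space} (hx : x ∈ Submodule.span ℤ (Set.range generators)) :
    ∃ n : ℤ, form x x = 2 * n := by
  obtain ⟨c, rfl⟩ := (Submodule.mem_span_range_iff_exists_fun ℤ).1 hx
  obtain ⟨hχ, hα, hβ, hγ, hδ, hε, hζ, hη⟩ := glue_coordinates
  set x := ∑ m, c m • generators m with hxc
  have v0 : x 0 = c 0 + 1/2 * c 23 + 1/2 * c 26 + 1/2 * c 28 + 1/2 * c 29 := by
    rw [hxc, coordinates, hχ, hα, hβ, hγ, hδ, hε, hζ, hη]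
    simp
    try ring
  have v1 : x 1 = c 1 + 1/2 * c 23 := by
    rw [hxc, coordinates, hχ, hα, hβ, hγ, hδ, hε, hζ, hη]
    simp
    try ring
  have v2 : x 2 = c 2 := by
    rw [hxc, coordinates, hχ, hα, hβ, hγ, hδ, hε, hζ, hη]
    simp
    try ring
  have v3 : x 3 = c 3 + 1/2 * c 26 + 1/2 * c 28 + 1/2 * c 29 := by
    rw [hxc, coordinates, hχ, hα, hβ, hγ, hδ, hε, hζ, hη]
    simp
    try ring
  have v4 : x 4 = c 4 + 1/2 * c 23 + 1/2 * c 24 + 1/2 * c 28 + 1/2 * c 29 := by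
    rw [hxc, coordinates, hχ, hα, hβ, hγ, hδ, hε, hζ, hη]
    simp
    try ring
  have v5 : x 5 = c 5 + 1/2 * c 24 + 1/2 * c 27 + 1/2 * c 28 + 1/2 * c 29 := by
    rw [hxc, coordinates, hχ, hα, hβ, hγ, hδ, hε, hζ, hη]
    simp
    try ring
  have v6 : x 6 = c 6 := by
    rw [hxc, coordinates, hχ, hα, hβ, hγ, hδ, hε, hζ, hη]
    simp
    try ring
  have v7 : x 7 = c 7 + 1/2 * c 23 + 1/2 * c 27 := by
    rw [hxc, coordinates, hχ, hα, hβ, hγ, hδ, hε, hζ, hη]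
    simp
    try ring
  have v8 : x 8 = c 8 + 1/2 * c 24 + 1/2 * c 25 := by
    rw [hxc, coordinates, hχ, hα, hβ, hγ, hδ, hε, hζ, hη]
    simp
    try ring
  have v9 : x 9 = c 9 + 1/2 * c 25 := by
    rw [hxc, coordinates, hχ, hα, hβ, hγ, hδ, hε, hζ, hη]
    simp
    try ring
  have v10 : x 10 = c 10 := by
    rw [hxc, coordinates, hχ, hα, hβ, hγ, hδ, hε, hζ, hη]
    simp
    try ring
  have v11 : x 11 = c 11 + 1/2 * c 24 := by
    rw [hxc, coordinates, hχ, hα, hβ, hγ, hδ, hε, hζ, hη]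
    simp
    try ring
  have v12 : x 12 = c 12 + 1/2 * c 25 + 1/2 * c 26 := by
    rw [hxc, coordinates, hχ, hα, hβ, hγ, hδ, hε, hζ, hη]
    simp
    try ring
  have v13 : x 13 = c 13 + 1/2 * c 26 + 1/2 * c 27 := by
    rw [hxc, coordinates, hχ, hα, hβ, hγ, hδ, hε, hζ, hη]
    simp
    try ring
  have v14 : x 14 = c 14 := by
    rw [hxc, coordinates, hχ, hα, hβ, hγ, hδ, hε, hζ, hη]
    simp
    try ring
  have v15 : x 15 = c 15 + 1/2 * c 25 + 1/2 * c 27 := by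
    rw [hxc, coordinates, hχ, hα, hβ, hγ, hδ, hε, hζ, hη]
    simp
    try ring
  have v16 : x 16 = c 16 + 1/2 * c 27 + 1/2 * c 28 := by
    rw [hxc, coordinates, hχ, hα, hβ, hγ, hδ, hε, hζ, hη]
    simp
    try ring
  have v17 : x 17 = c 17 + 1/2 * c 27 + 1/2 * c 29 := by
    rw [hxc, coordinates, hχ, hα, hβ, hγ, hδ, hε, hζ, hη]
    simp
    try ring
  have v18 : x 18 = c 18 + 1/2 * c 22 + 1/4 * c 23 - 1/4 * c 24 + 1/4 * c 25 - 1/4 * c 26 := by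
    rw [hxc, coordinates, hχ, hα, hβ, hγ, hδ, hε, hζ, hη]
    simp
    try ring
  have v19 : x 19 = c 19 + 1/2 * c 22 + 1/4 * c 23 + 1/4 * c 24 + 1/4 * c 25 + 1/4 * c 26 + 1/2 * c 27 := by
    rw [hxc, coordinates, hχ, hα, hβ, hγ, hδ, hε, hζ, hη]
    simp
    try ring
  have v20 : x 20 = c 20 + 1/2 * c 28 := by
    rw [hxc, coordinates, hχ, hα, hβ, hγ, hδ, hε, hζ, hη]
    simp
    try ring
  have v21 : x 21 = c 21 + 1/2 * c 29 := by
    rw [hxc, coordinates, hχ, hα, hβ, hγ, hδ, hε, hζ, hη]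
    simp
    try ring
  refine ⟨c 0 * (-c 0 + c 2 - c 23 - c 26 - c 28 - c 29)
      + c 1 * (-c 1 + c 2 - c 23)
      + c 2 * (-c 2 + c 3 + c 23 + c 26 + c 28 + c 29)
      + c 3 * (-c 3 - c 26 - c 28 - c 29)
      + c 4 * (-c 4 + c 6 - c 23 - c 24 - c 28 - c 29)
      + c 5 * (-c 5 + c 6 - c 24 - c 27 - c 28 - c 29)
      + c 6 * (-c 6 + c 7 + c 23 + c 24 + c 27 + c 28 + c 29)
      + c 7 * (-c 7 - c 23 - c 27)
      + c 8 * (-c 8 + c 10 - c 24 - c 25)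
      + c 9 * (-c 9 + c 10 - c 25)
      + c 10 * (-c 10 + c 11 + c 24 + c 25)
      + c 11 * (-c 11 - c 24)
      + c 12 * (-c 12 + c 14 - c 25 - c 26)
      + c 13 * (-c 13 + c 14 - c 26 - c 27)
      + c 14 * (-c 14 + c 15 + c 25 + c 26 + c 27)
      + c 15 * (-c 15 - c 25 - c 27)
      + c 16 * (-c 16 - c 27 - c 28)
      + c 17 * (-c 17 - c 27 - c 29)
      + c 18 * (-2 * c 18 - 2 * c 22 - c 23 + c 24 - c 25 + c 26)
      + c 19 * (2 * c 19 + 2 * c 22 + c 23 + c 24 + c 25 + c 26 + 2 * c 27)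
      + c 20 * (c 20 + c 28)
      + c 21 * (c 21 + c 29)
      + c 22 * (c 24 + c 26 + c 27)
      + c 23 * (-c 23 - c 28 - c 29)
      + c 24 * (-c 24 - c 28 - c 29)
      + c 25 * (-c 25)
      + c 26 * (-c 26 - c 28 - c 29)
      + c 27 * (-c 27 - c 28 - c 29)
      + c 28 * (-c 28 - 2 * c 29)
      + c 29 * (-c 29), ?_⟩
  simp only [form, LinearMap.mk₂_apply, d4, Matrix.cons_val]
  simp only [v0, v1, v2, v3, v4, v5, v6, v7, v8, v9, v10, v11, v12, v13, v14, v15, v16, v17, v18, v19, v20, v21]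
  push_cast
  ring

theorem single_mem (k : Fin 22) :
    (Pi.single k 1 : Space) ∈ Submodule.span ℤ (Set.range generators) :=
  Submodule.subset_span ⟨k.castLE (by norm_num), by fin_cases k <;> rfl⟩

theorem d4_eq (u : Fin 4 → ℚ) : d4 u u = -((2 * u 0 - u 2) ^ 2 + (2 * u 1 - u 2) ^ 2
    + (2 * u 3 - u 2) ^ 2 + u 2 ^ 2) / 2 := by
  unfold d4
  ring

theorem d4_nonpos (u : Fin 4 → ℚ) : d4 u u ≤ 0 := by
  rw [d4_eq]
  linarith [sq_nonneg (2 * u 0 - u 2), sq_nonneg (2 * u 1 - u 2), sq_nonneg (2 * u 3 - u 2),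
    sq_nonneg (u 2)]

theorem d4_eq_zero {u : Fin 4 → ℚ} (h : 0 ≤ d4 u u) : u 0 = 0 ∧ u 1 = 0 ∧ u 2 = 0 ∧ u 3 = 0 := by
  rw [d4_eq] at h
  have h0 := sq_nonneg (2 * u 0 - u 2)
  have h1 := sq_nonneg (2 * u 1 - u 2)
  have h3 := sq_nonneg (2 * u 3 - u 2)
  have h2 := sq_nonneg (u 2)
  have e0 : 2 * u 0 - u 2 = 0 := pow_eq_zero_iff two_ne_zero |>.1 (by linarith)
  have e1 : 2 * u 1 - u 2 = 0 := pow_eq_zero_iff two_ne_zero |>.1 (by linarith)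
  have e3 : 2 * u 3 - u 2 = 0 := pow_eq_zero_iff two_ne_zero |>.1 (by linarith)
  have e2 : u 2 = 0 := pow_eq_zero_iff two_ne_zero |>.1 (by linarith)
  exact ⟨by linarith, by linarith, e2, by linarith⟩

theorem eq_zero_of_nonneg {x : Space} (h : 0 ≤ d4 ![x 0, x 1, x 2, x 3] ![x 0, x 1, x 2, x 3]
      + d4 ![x 4, x 5, x 6, x 7] ![x 4, x 5, x 6, x 7]
      + d4 ![x 8, x 9, x 10, x 11] ![x 8, x 9, x 10, x 11]
      + d4 ![x 12, x 13, x 14, x 15] ![x 12, x 13, x 14, x 15]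
      - 2 * (x 16 * x 16) - 2 * (x 17 * x 17) - 4 * (x 18 * x 18)
      - 4 * (x 19 * x 19) - 2 * (x 20 * x 20) - 2 * (x 21 * x 21)) : x = 0 := by
  have p0 := d4_nonpos ![x 0, x 1, x 2, x 3]
  have p1 := d4_nonpos ![x 4, x 5, x 6, x 7]
  have p2 := d4_nonpos ![x 8, x 9, x 10, x 11]
  have p3 := d4_nonpos ![x 12, x 13, x 14, x 15]
  have q := fun k => mul_self_nonneg (x k)
  obtain ⟨z0, z1, z2, z3⟩ := d4_eq_zero (u := ![x 0, x 1, x 2, x 3])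
    (by linarith [q 16, q 17, q 18, q 19, q 20, q 21])
  obtain ⟨z4, z5, z6, z7⟩ := d4_eq_zero (u := ![x 4, x 5, x 6, x 7])
    (by linarith [q 16, q 17, q 18, q 19, q 20, q 21])
  obtain ⟨z8, z9, z10, z11⟩ := d4_eq_zero (u := ![x 8, x 9, x 10, x 11])
    (by linarith [q 16, q 17, q 18, q 19, q 20, q 21])
  obtain ⟨z12, z13, z14, z15⟩ := d4_eq_zero (u := ![x 12, x 13, x 14, x 15])
    (by linarith [q 16, q 17, q 18, q 19, q 20, q 21])
  have z16 : x 16 = 0 := mul_self_eq_zero.1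
    (by linarith [q 16, q 17, q 18, q 19, q 20, q 21])
  have z17 : x 17 = 0 := mul_self_eq_zero.1
    (by linarith [q 16, q 17, q 18, q 19, q 20, q 21])
  have z18 : x 18 = 0 := mul_self_eq_zero.1
    (by linarith [q 16, q 17, q 18, q 19, q 20, q 21])
  have z19 : x 19 = 0 := mul_self_eq_zero.1
    (by linarith [q 16, q 17, q 18, q 19, q 20, q 21])
  have z20 : x 20 = 0 := mul_self_eq_zero.1
    (by linarith [q 16, q 17, q 18, q 19, q 20, q 21])
  have z21 : x 21 = 0 := mul_self_eq_zero.1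
    (by linarith [q 16, q 17, q 18, q 19, q 20, q 21])
  ext k
  fin_cases k
  exacts [z0, z1, z2, z3, z4, z5, z6, z7, z8, z9, z10,
    z11, z12, z13, z14, z15, z16, z17, z18, z19, z20, z21]

theorem form_nondegenerate {x : Space} (h : ∀ k, form x (Pi.single k 1) = 0) : x = 0 := by
  have hy : ∀ y, form x y = 0 := fun y => by
    rw [← (Pi.basisFun ℚ (Fin 22)).sum_repr y, map_sum]
    exact Finset.sum_eq_zero fun k _ => by rw [map_smul, Pi.basisFun_apply, h, smul_zero]
  have key := hy ![x 0, x 1, x 2, x 3, x 4, x 5, x 6, x 7, x 8, x 9, x 10, x 11, x 12, x 13, x 14,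
    x 15, x 16, x 17, x 18, -x 19, -x 20, -x 21]
  rw [form, LinearMap.mk₂_apply] at key
  apply eq_zero_of_nonneg
  rw [← key]
  apply le_of_eq
  change d4 ![x 0, x 1, x 2, x 3] ![x 0, x 1, x 2, x 3]
      + d4 ![x 4, x 5, x 6, x 7] ![x 4, x 5, x 6, x 7]
      + d4 ![x 8, x 9, x 10, x 11] ![x 8, x 9, x 10, x 11]
      + d4 ![x 12, x 13, x 14, x 15] ![x 12, x 13, x 14, x 15]
      - 2 * (x 16 * x 16) - 2 * (x 17 * x 17) - 4 * (x 18 * x 18)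
      + 4 * (x 19 * -x 19) + 2 * (x 20 * -x 20) + 2 * (x 21 * -x 21) = _
  ring

/-- The K3 lattice: the overlattice of `W` generated by the eight glue vectors. -/
noncomputable def lattice : EvenLattice Space where
  form := form
  carrier := Submodule.span ℤ (Set.range generators)
  fg := Submodule.fg_span (Set.finite_range _)
  symm := form_symm
  even _ hx := form_even hx
  nondegenerate x _ h := by
    exact form_nondegenerate fun k => h _ (single_mem k)

/-- The isometry `τ*` of `Λ_K3 ⊗ ℚ`: it permutes the four copies of `D₄` cyclically by
`eᵢ ↦ fᵢ ↦ gᵢ ↦ hᵢ ↦ eᵢ`, swaps `a₁` and `a₂`, sends `σ` to `-σ` and fixes `ρ`, `ω₁`, `ω₂`. -/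
noncomputable def τ : Space →ₗ[ℚ] Space :=
  (Pi.basisFun ℚ (Fin 22)).constr ℚ
    ![f₁, f₂, f₃, f₄, g₁, g₂, g₃, g₄, h₁, h₂, h₃, h₄, e₁, e₂, e₃, e₄, a₂, a₁, -σ, ρ, ω₁, ω₂]

/-- The invariant lattice `Λ_K3^⟨τ⟩`. -/
noncomputable def invariantLattice : Submodule ℤ Space where
  carrier := {y | y ∈ lattice.carrier ∧ τ y = y}
  zero_mem' := ⟨zero_mem _, map_zero _⟩
  add_mem' hx hy := ⟨add_mem hx.1 hy.1, by rw [map_add, hx.2, hy.2]⟩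
  smul_mem' c x hx := ⟨Submodule.smul_mem _ c hx.1, by rw [map_zsmul, hx.2]⟩

/-- The orthogonal complement of the invariant lattice in `Λ_K3`. -/
noncomputable def coinvariantLattice : Submodule ℤ Space where
  carrier := {x | x ∈ lattice.carrier ∧ ∀ y ∈ invariantLattice, form x y = 0}
  zero_mem' := ⟨zero_mem _, fun _ _ => by simp⟩
  add_mem' hx hy := ⟨add_mem hx.1 hy.1, fun z hz => by simp [hx.2 z hz, hy.2 z hz]⟩
  smul_mem' c x hx := ⟨Submodule.smul_mem _ c hx.1, fun z hz => by
    rw [map_zsmul, LinearMap.smul_apply, hx.2 z hz, smul_zero]⟩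

/-- The lattice `Ω₄`, the co-invariant lattice of `τ*` with the form of `Λ_K3`. -/
noncomputable def Ω₄ : EvenLattice Space where
  form := form
  carrier := coinvariantLattice
  fg := isNoetherian_submodule.1 (isNoetherian_of_fg_of_noetherian _ lattice.fg) _
    fun _ hx => hx.1
  symm := form_symm
  even _ hx := form_even hx.1
  nondegenerate x hx h := by
    have hxx := h x hx
    have hτ : ∀ k : Fin 22, τ (Pi.single k 1) =
      ![f₁, f₂, f₃, f₄, g₁, g₂, g₃, g₄, h₁, h₂, h₃, h₄, e₁, e₂, e₃, e₄, a₂, a₁, -σ, ρ, ω₁, ω₂]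
        k := by
      intro k
      rw [τ, ← Pi.basisFun_apply, Module.Basis.constr_basis]
    have h1 : form x ρ = 0 := hx.2 ρ ⟨single_mem 19, hτ 19⟩
    have h2 : form x ω₁ = 0 := hx.2 ω₁ ⟨single_mem 20, hτ 20⟩
    have h3 : form x ω₂ = 0 := hx.2 ω₂ ⟨single_mem 21, hτ 21⟩
    simp only [form, LinearMap.mk₂_apply, d4, ρ, ω₁, ω₂] at h1 h2 h3
    simp [Fin.ext_iff] at h1 h2 h3
    rw [form, LinearMap.mk₂_apply] at hxx
    apply eq_zero_of_nonneg
    rw [← hxx, h1, h2, h3]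
    apply le_of_eq
    ring

/-! ### Elements of `Ω₄* ⊂ Ω₄ ⊗ ℚ` that represent the classes -/

/-- Representative of the class `(2, 0, 15)`. -/
def x_two_zero : Space :=
  (1 / 2 : ℚ) • ((3 : ℚ) • e₃ - f₃ - g₃ - h₃)

/-- Representative of the class `(2, 1/2, 32)`. -/
def x_two_half : Space :=
  (1 / 2 : ℚ) • ((2 : ℚ) • e₁ - f₁ - g₁ + e₄ - f₄ + α - γ + σ
    + (1 / 2 : ℚ) • (e₂ - g₂ + e₄ - g₄ + a₁ - a₂ + σ))

/-- Representative of the class `(2, 1, 6)`. -/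
def x_two_one_six : Space :=
  (1 / 2 : ℚ) • σ

/-- Representative of the class `(2, 1, 10)`. -/
def x_two_one_ten : Space :=
  (1 / 2 : ℚ) • (σ + (3 : ℚ) • e₃ - f₃ - g₃ - h₃)

/-- Representative of the class `(4, 0, 240)`. -/
def x_four_zero : Space :=
  (1 / 4 : ℚ) • ((3 : ℚ) • ((3 : ℚ) • e₃ - f₃ - g₃ - h₃)
    + (2 : ℚ) • ((2 : ℚ) • e₁ - f₁ - g₁ + e₄ - f₄ + α - γ)
    + e₂ - g₂ + e₄ - g₄ + a₁ - a₂ + σ)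

/-- Representative of the class `(4, 1/2, 240)`. -/
def x_four_half : Space :=
  (1 / 4 : ℚ) • ((3 : ℚ) • ((3 : ℚ) • e₁ - f₁ - g₁ - h₁))

/-- Representative of the class `(4, 1, 240)`. -/
def x_four_one : Space :=
  (1 / 4 : ℚ) • ((3 : ℚ) • ((3 : ℚ) • e₁ - f₁ - g₁ - h₁ + (3 : ℚ) • α - β - γ - δ)
    + (2 : ℚ) • (e₂ - g₂ + e₄ - g₄ + σ))

/-- Representative of the class `(4, 3/2, 240)`. -/
def x_four_three_halves : Space :=
  (1 / 4 : ℚ) • ((2 : ℚ) • (e₁ - g₁ + e₂ - g₂) + a₁ - a₂ + σ)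

end K3

/-!
The proof is an explicit computation in coordinates, organised so that the finite checks are small.

*Coordinates.* By the elementary divisor theorem there is a basis `dualVec` of `Ω₄*` such that
suitable multiples `mult i • dualVec i`, with `mult = (4, 4, 4, 4, 2, 2, 1, …, 1)`, form a basis of
`Ω₄`. That these vectors are bases follows from two facts. The K3 lattice is unimodular and
`Ω₄` is primitive in it, so the coordinates of a vector of `Ω₄` are its pairings with elements
`coordVec i` of the K3 lattice, hence integers (`mem_Ω₄_iff`); here `Ω₄ ⊗ ℚ` is the space of
vectors whose average over the orbits of `τ*` vanishes (`TraceZero`). The matrix of pairings of the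
two bases has an integral inverse, so a vector of `Ω₄ ⊗ ℚ` that pairs integrally with `Ω₄` has
integral coordinates (`mem_dual_iff`). Consequently `A_{Ω₄} = (ℤ/4)⁴ × (ℤ/2)²` (`discGroupEquiv`),
and order and square become functions of six digits (`addOrderOf_element`, `discForm_disc_six`),
which settles `∼` and all the cardinalities of its classes.

*Lower bound for the orbits.* An integral matrix that preserves the Gram matrix and `Ω₄` gives an
isometry, whose action on `A_{Ω₄}` is the one on the digits (`discMap_disc`). Three involutions
suffice: a search shows that the orbits of the group they generate are as large as
claimed (`mem_orbit`).

*Upper bound for the orbits.* Isometries preserve order and square, so six of the seven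
classes are single orbits. For the class `(2, 1)`, the number of `s` for which `s` and `s + r` are
both isotropic is invariant under isometries (`isotropicPairs_discMap`); it is `160` for `r = σ/2`
and `96` for the other representative, so their orbits are disjoint.
-/

namespace K3

/-! ### A pair of bases adapted to the coinvariant lattice and its dual -/

/-- A `ℤ`-basis of the dual lattice `Ω₄*`; the table lists the coordinates multiplied by `8`. It is
adapted to `Ω₄ ⊂ Ω₄*`: the vectors `mult i • dualVec i` form a basis of `Ω₄`. -/
def dualVec (i : Fin 14) : Space := fun k =>
  ((![![-2, -2, -2, 0, -2, 2, -2, -4, -2, -2, -2, 0, 6, 2, 6, 4, 0, 0, 0, 0, 0, 0],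
    ![2, 1, 4, 3, 2, 1, 4, 3, -2, -3, -4, -5, -2, 1, -4, -1, 0, 0, 2, 0, 0, 0],
    ![0, -2, 2, 0, -4, -2, -6, -4, 0, 2, 2, 4, 4, 2, 2, 0, 0, 0, 0, 0, 0, 0],
    ![0, -4, 0, 2, 0, 0, 0, -2, 0, 4, 0, 2, 0, 0, 0, -2, 0, 0, 0, 0, 0, 0],
    ![0, -2, 0, 2, 0, 2, 0, -2, 0, -2, 0, 2, 0, 2, 0, -2, 0, 0, 0, 0, 0, 0],
    ![-2, -2, -4, 0, 2, 2, 4, 0, -2, -2, -4, 0, 2, 2, 4, 0, -2, 2, -2, 0, 0, 0],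
    ![0, 8, 0, 0, 0, 0, 0, 0, 0, -8, 0, 0, 0, 0, 0, 0, 0, 0, 0, 0, 0, 0],
    ![-4, 0, -8, -4, 0, 0, 0, 0, 4, 4, 8, 8, 0, -4, 0, -4, 0, 0, -4, 0, 0, 0],
    ![0, 4, 0, -4, 0, -4, 0, 4, 0, -4, 0, -4, 0, 4, 0, 4, 0, 0, 0, 0, 0, 0],
    ![0, 0, 0, 0, 0, 0, 0, 0, 8, 8, 8, 8, -8, -8, -8, -8, 0, 0, 0, 0, 0, 0],
    ![0, -4, 0, -4, -8, -4, -8, -4, 0, 4, 0, 4, 8, 4, 8, 4, 0, 0, 0, 0, 0, 0],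
    ![0, 0, 0, 0, 8, 0, 8, 8, 0, 0, 0, 0, -8, 0, -8, -8, 0, 0, 0, 0, 0, 0],
    ![4, 0, 8, 4, -4, -4, -8, -8, -4, 0, 0, 4, 4, 4, 0, 0, 0, 0, 0, 0, 0, 0],
    ![0, 0, 0, 0, 4, -4, 0, 0, 0, 4, 0, 4, -4, 0, 0, -4, 0, 0, -4, 0, 0, 0]] :
      Fin 14 → Fin 22 → ℤ) i k : ℚ) / 8

/-- The elementary divisors of `Ω₄ ⊂ Ω₄*`. -/
def mult : Fin 14 → ℤ := ![4, 4, 4, 4, 2, 2, 1, 1, 1, 1, 1, 1, 1, 1]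

/-- Elements of the K3 lattice whose pairings with a vector of `Ω₄` are its coordinates in the basis
`mult i • dualVec i`; the table lists the coordinates multiplied by `4`. Such elements exist because
`Ω₄` is a primitive sublattice of a unimodular lattice. -/
def coordVec (i : Fin 14) : Space := fun k =>
  ((![![2, 0, 0, 2, -2, -2, -4, 0, 0, 0, 0, 0, 0, 0, 0, 0, 0, 2, 0, 0, 0, -2],
    ![0, 0, 0, 0, 0, 0, 0, 0, 0, 2, 4, 2, 0, 2, 4, 2, 0, 2, 1, 1, 0, 2],
    ![0, 0, 0, 0, 0, 2, 4, 2, -2, 0, 0, 2, -2, 0, 0, 2, 0, -2, 0, 2, 2, 0],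
    ![0, 0, 0, 0, 0, 2, 0, 2, -2, -2, -4, 0, -2, -2, -4, 0, 0, 0, -1, 1, 2, -2],
    ![0, 0, 0, 0, 2, -2, 0, 0, 0, 0, 0, 0, 2, -2, 0, 0, 0, 2, 1, -1, 0, -2],
    ![0, 0, 0, 0, 0, 0, 0, 0, 0, 0, 0, 0, 0, 0, 0, 0, 0, -4, 0, 0, 0, 0],
    ![0, -2, 0, -2, 2, 4, 4, 2, 0, 0, 0, 0, -2, -2, -4, 0, 0, 0, -2, 0, 0, 0],
    ![0, 0, 0, 0, 0, -2, -4, -2, 0, 0, 0, 0, 0, 2, 4, 2, 0, 4, 2, 0, -2, -2],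
    ![2, 0, 4, 2, -2, 0, 0, 2, -6, -4, -4, -2, -2, -4, 0, -2, 0, 0, 0, 2, -2, -2],
    ![2, 0, 0, 2, -2, -2, -4, 0, -2, 0, 0, -2, 2, 2, 4, 0, 2, 2, 0, 0, -2, -2],
    ![0, 0, 0, 0, 2, -2, -4, -4, 4, 2, 4, -2, 2, 0, 0, -2, -2, 2, 0, -2, -2, 2],
    ![2, 0, 4, 2, -4, -4, -4, -4, 2, -2, 0, -4, 0, -2, 0, -2, 0, 0, -2, 0, 0, 0],
    ![0, 0, 0, 0, 0, -2, -4, -2, 4, 0, 0, -4, 4, 2, 4, -2, 0, 0, 0, -2, -2, 2],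
    ![0, 0, -4, 0, 0, 2, 0, 2, 0, 4, 4, 4, 0, 2, 0, 2, -4, 0, 2, 0, -2, 2]] :
      Fin 14 → Fin 22 → ℤ) i k : ℚ) / 4

/-- Four times the Gram matrix of `dualVec`; the form takes values in `¼ℤ` on `Ω₄*`. -/
def gram : Matrix (Fin 14) (Fin 14) ℤ :=
  !![-6, 2, -3, -1, -2, -2, 0, 0, 4, 4, -4, 8, -4, 4;
     2, -6, 2, 1, 0, 2, 0, 8, -4, 4, 4, -4, 0, 4;
     -3, 2, -6, -3, -2, 0, 4, 0, 4, 0, -8, 4, -8, 0;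
     -1, 1, -3, -6, -2, -2, 8, 0, 8, -4, -4, 0, -4, -4;
     -2, 0, -2, -2, -4, -2, 0, 0, 4, 0, 0, 0, -4, 0;
     -2, 2, 0, -2, -2, -6, 0, -4, 4, 0, 0, 0, 0, -4;
     0, 0, 4, 8, 0, 0, -16, -4, -8, 4, 8, 0, 4, 4;
     0, 8, 0, 0, 0, -4, -4, -16, 4, -8, 0, 0, 4, -8;
     4, -4, 4, 8, 4, 4, -8, 4, -16, 8, 4, -4, 4, 4;
     4, 4, 0, -4, 0, 0, 4, -8, 8, -16, 0, -4, 4, -8;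
     -4, 4, -8, -4, 0, 0, 8, 0, 4, 0, -16, 8, -8, 0;
     8, -4, 4, 0, 0, 0, 0, 0, -4, -4, 8, -16, 4, -8;
     -4, 0, -8, -4, -4, 0, 4, 4, 4, 4, -8, 4, -16, 0;
     4, 4, 0, -4, 0, -4, 4, -8, 4, -8, 0, -8, 0, -16]

/-- The matrix of pairings of the basis `dualVec` of `Ω₄*` with the basis `mult i • dualVec i`
of `Ω₄`. -/
def pairing : Matrix (Fin 14) (Fin 14) ℤ := Matrix.of fun i j => gram i j * mult j / 4

/-- The inverse of `pairing`. -/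
def pairingInv : Matrix (Fin 14) (Fin 14) ℤ :=
  !![-6, -3, 3, 2, 0, 1, 1, -1, -1, -2, -1, -1, -1, -1;
     -3, -6, 1, 3, -1, 1, 1, -2, 0, -1, -1, 1, 0, -2;
     3, 1, -6, -2, 1, -1, -1, 1, 0, 1, 2, 1, 2, 0;
     2, 3, -2, -6, 1, 0, -2, 1, -1, 1, 1, 0, 1, 1;
     0, -2, 2, 2, -3, 1, 1, -1, 0, 0, -1, 1, 0, -1;
     2, 2, -2, 0, 1, -2, 0, 1, 0, 0, 1, 0, 0, 1;
     4, 4, -4, -8, 2, 0, -4, 2, 0, 2, 1, 0, 2, 1;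
     -4, -8, 4, 4, -2, 2, 2, -4, 0, -1, -2, 1, -1, -2;
     -4, 0, 0, -4, 0, 0, 0, 0, -4, -2, 1, 0, 0, 0;
     -8, -4, 4, 4, 0, 0, 2, -1, -2, -4, -1, -1, -2, -1;
     -4, -4, 8, 4, -2, 2, 1, -2, 1, -1, -4, -1, -2, -1;
     -4, 4, 4, 0, 2, 0, 0, 1, 0, -1, -1, -4, -2, 2;
     -4, 0, 8, 4, 0, 0, 2, -1, 0, -2, -2, -2, -4, 1;
     -4, -8, 0, 4, -2, 2, 1, -2, 0, -1, -1, 2, 1, -4]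

/-- The coefficients of the glue vectors in `mult i • dualVec i`, up to an element of `W`. -/
def dualVecGlue : Fin 14 → Fin 8 → ℤ :=
  ![![0, 0, 0, 0, 0, 0, 0, 0],
    ![0, -1, -1, -1, -1, 0, 0, 0],
    ![0, 0, 0, 0, 0, 0, 0, 0],
    ![0, 0, 0, 0, 0, 0, 0, 0],
    ![0, -1, -1, -1, -1, 0, 0, 0],
    ![0, -1, 0, -1, 0, 1, 0, 0],
    ![0, 0, 0, 0, 0, 0, 0, 0],
    ![0, 0, 0, -1, 1, 0, 0, 0],
    ![0, -1, -1, -1, -1, 0, 0, 0],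
    ![0, 0, 0, 0, 0, 0, 0, 0],
    ![0, -1, -1, -1, -1, 0, 0, 0],
    ![0, 0, 0, 0, 0, 0, 0, 0],
    ![0, 0, -1, 0, 1, 0, 0, 0],
    ![0, 0, -1, 1, 0, 0, 0, 0]]

/-- The coefficients of the glue vectors in `coordVec i`, up to an element of `W`. -/
def coordVecGlue : Fin 14 → Fin 8 → ℤ :=
  ![![0, 0, 0, 0, 0, 0, 0, 1],
    ![0, 0, -1, -1, -1, 0, 0, 1],
    ![0, 0, -1, 0, 1, 1, 1, 0],
    ![0, 0, 0, -1, 0, 1, 1, 1],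
    ![0, 0, 0, 0, -1, 0, 0, 1],
    ![0, 0, 0, 0, 0, 0, 0, 0],
    ![0, -1, 0, 0, 1, 0, 0, 0],
    ![1, 0, 0, 0, 0, 1, 1, 1],
    ![0, 0, -1, 0, 1, 1, 1, 1],
    ![0, 0, -1, 0, 1, 0, 1, 1],
    ![0, 0, -1, -1, 0, 0, 1, 1],
    ![0, 0, 0, -1, 1, 0, 0, 0],
    ![0, 0, 0, 0, 0, 1, 1, 1],
    ![1, 0, 0, 0, 0, 1, 1, 1]]

/-- The eight glue vectors of the K3 lattice. -/
def glue : Fin 8 → Space := ![χ, α, β, γ, δ, ε, ζ, η]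

theorem glue_mem (i : Fin 8) : glue i ∈ lattice.carrier :=
  Submodule.subset_span ⟨i.natAdd 22, by fin_cases i <;> rfl⟩

/-- A vector lies in the K3 lattice if it differs by a vector with integral coordinates, that is,
by an element of `W`, from an integral combination of glue vectors. -/
theorem mem_lattice_of_glue {x : Space} (t : Fin 8 → ℤ)
    (h : ∀ k, (x k - ∑ i, t i * glue i k).den = 1) : x ∈ lattice.carrier := by
  have hx : x = ∑ i, t i • glue i +
      ∑ k, (x k - ∑ i, t i * glue i k).num • (Pi.single k 1 : Space) := by
    ext k
    have hk : (((x k - ∑ i, t i * glue i k).num : ℤ) : ℚ) = x k - ∑ i, t i * glue i k :=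
      Rat.den_eq_one_iff _ |>.1 (h k)
    simp [Finset.sum_apply, Pi.single_apply, hk]
  rw [hx]
  exact add_mem (sum_mem fun i _ => Submodule.smul_mem _ _ (glue_mem i))
    (sum_mem fun k _ => Submodule.smul_mem _ _ (single_mem k))

/-- Membership in `Ω₄ ⊗ ℚ`, in coordinates: the average over the orbit under `τ*` vanishes. There is
no condition on the coordinate at `σ`, since `τ*` changes the sign of `σ`. -/
structure TraceZero (x : Space) : Prop where
  D₄ : ∀ i : Fin 4, x (i.castLE (by decide)) + x (i.natAdd 4 |>.castLE (by decide)) +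
    x (i.natAdd 8 |>.castLE (by decide)) + x (i.natAdd 12 |>.castLE (by decide)) = 0
  A₁ : x 16 + x 17 = 0
  ρ : x 19 = 0
  ω₁ : x 20 = 0
  ω₂ : x 21 = 0

/-- A basis of `Ω₄ ⊗ ℚ`. -/
def differences : Fin 14 → Space :=
  ![e₁ - h₁, e₂ - h₂, e₃ - h₃, e₄ - h₄, f₁ - h₁, f₂ - h₂, f₃ - h₃, f₄ - h₄,
    g₁ - h₁, g₂ - h₂, g₃ - h₃, g₄ - h₄, a₁ - a₂, σ]

theorem gram_eq : ∀ i j, form (dualVec i) (dualVec j) = (gram i j : ℚ) / 4 := by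
  decide +kernel

theorem differences_eq : ∀ k l, differences k l =
    ∑ i, mult i * form (differences k) (coordVec i) * dualVec i l := by
  decide +kernel

theorem pairing_mul_pairingInv : pairing * pairingInv = 1 := by
  decide +kernel

theorem pairing_eq : ∀ i j, (pairing i j : ℚ) = gram i j * mult j / 4 := by
  decide +kernel

theorem coordVec_mem (i : Fin 14) : coordVec i ∈ lattice.carrier :=
  mem_lattice_of_glue (coordVecGlue i) (by revert i; decide +kernel)

theorem mult_smul_dualVec_mem (i : Fin 14) : mult i • dualVec i ∈ lattice.carrier :=
  mem_lattice_of_glue (dualVecGlue i) (by revert i; decide +kernel)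

theorem traceZero_dualVec (i : Fin 14) : TraceZero (dualVec i) :=
  ⟨by revert i; decide +kernel, by revert i; decide +kernel, by revert i; decide +kernel,
    by revert i; decide +kernel, by revert i; decide +kernel⟩

/-! ### Integral coordinates on `Ω₄` and `Ω₄*` -/

theorem form_apply (x y : Space) : form x y =
    d4 ![x 0, x 1, x 2, x 3] ![y 0, y 1, y 2, y 3]
      + d4 ![x 4, x 5, x 6, x 7] ![y 4, y 5, y 6, y 7]
      + d4 ![x 8, x 9, x 10, x 11] ![y 8, y 9, y 10, y 11]
      + d4 ![x 12, x 13, x 14, x 15] ![y 12, y 13, y 14, y 15]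
      - 2 * (x 16 * y 16) - 2 * (x 17 * y 17)
      - 4 * (x 18 * y 18) + 4 * (x 19 * y 19) + 2 * (x 20 * y 20) + 2 * (x 21 * y 21) := rfl

theorem τ_apply (x : Space) : τ x = ![x 12, x 13, x 14, x 15, x 0, x 1, x 2, x 3, x 4, x 5, x 6,
    x 7, x 8, x 9, x 10, x 11, x 17, x 16, -x 18, x 19, x 20, x 21] := by
  rw [τ, Module.Basis.constr_apply_fintype]
  ext k
  simp only [Pi.basisFun_equivFun, LinearEquiv.refl_apply, Fin.sum_univ_succ, Pi.add_apply,
    Pi.smul_apply, smul_eq_mul]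
  fin_cases k <;>
    simp [e₁, e₂, e₃, e₄, f₁, f₂, f₃, f₄, g₁, g₂, g₃, g₄, h₁, h₂, h₃, h₄, a₁, a₂, σ, ρ, ω₁, ω₂,
      Fin.ext_iff]

theorem single_add_mem_invariantLattice (i : Fin 4) :
    (Pi.single (i.castLE (by decide)) 1 + Pi.single (i.natAdd 4 |>.castLE (by decide)) 1 +
      Pi.single (i.natAdd 8 |>.castLE (by decide)) 1 +
      Pi.single (i.natAdd 12 |>.castLE (by decide)) 1 : Space) ∈ invariantLattice := by
  refine ⟨add_mem (add_mem (add_mem (single_mem _) (single_mem _)) (single_mem _))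
    (single_mem _), ?_⟩
  rw [τ_apply]
  revert i
  decide +kernel

theorem TraceZero.of_mem {x : Space} (hx : x ∈ coinvariantLattice) : TraceZero x := by
  have hD := fun i => hx.2 _ (single_add_mem_invariantLattice i)
  have hA := hx.2 (Pi.single 16 1 + Pi.single 17 1)
    ⟨add_mem (single_mem _) (single_mem _), by rw [τ_apply]; decide +kernel⟩
  have hρ := hx.2 (Pi.single 19 1) ⟨single_mem _, by rw [τ_apply]; decide +kernel⟩
  have hω₁ := hx.2 (Pi.single 20 1) ⟨single_mem _, by rw [τ_apply]; decide +kernel⟩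
  have hω₂ := hx.2 (Pi.single 21 1) ⟨single_mem _, by rw [τ_apply]; decide +kernel⟩
  have h0 := hD 0
  have h1 := hD 1
  have h2 := hD 2
  have h3 := hD 3
  simp [form_apply, d4, Fin.ext_iff] at h0 h1 h2 h3 hA hρ hω₁ hω₂
  refine ⟨fun i => ?_, by linarith, hρ, hω₁, hω₂⟩
  fin_cases i <;> simp <;> linarith

theorem TraceZero.form_eq_zero {x y : Space} (hx : TraceZero x) (hy : y ∈ invariantLattice) :
    form x y = 0 := by
  have hτ := hy.2
  rw [τ_apply] at hτ
  have h := fun k => congrFun hτ k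
  have p0 : y 12 = y 0 := h 0
  have p1 : y 13 = y 1 := h 1
  have p2 : y 14 = y 2 := h 2
  have p3 : y 15 = y 3 := h 3
  have p4 : y 0 = y 4 := h 4
  have p5 : y 1 = y 5 := h 5
  have p6 : y 2 = y 6 := h 6
  have p7 : y 3 = y 7 := h 7
  have p8 : y 4 = y 8 := h 8
  have p9 : y 5 = y 9 := h 9
  have p10 : y 6 = y 10 := h 10
  have p11 : y 7 = y 11 := h 11
  have p16 : y 17 = y 16 := h 16
  have p18 : y 18 = 0 := by
    have : -y 18 = y 18 := h 18
    linarith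
  have d0 : x 0 + x 4 + x 8 + x 12 = 0 := hx.D₄ 0
  have d1 : x 1 + x 5 + x 9 + x 13 = 0 := hx.D₄ 1
  have d2 : x 2 + x 6 + x 10 + x 14 = 0 := hx.D₄ 2
  have d3 : x 3 + x 7 + x 11 + x 15 = 0 := hx.D₄ 3
  simp only [form_apply, d4, Matrix.cons_val, p0, p1, p2, p3, p4, p5, p6, p7, p8, p9, p10, p11,
    p16, p18, hx.ρ, hx.ω₁, hx.ω₂]
  linear_combination (-2 * y 8 + y 10) * d0 + (-2 * y 9 + y 10) * d1
    + (-2 * y 10 + y 8 + y 9 + y 11) * d2 + (-2 * y 11 + y 10) * d3 - 2 * y 16 * hx.A₁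

theorem mem_coinvariantLattice {x : Space} :
    x ∈ coinvariantLattice ↔ x ∈ lattice.carrier ∧ TraceZero x :=
  ⟨fun h => ⟨h.1, .of_mem h⟩, fun h => ⟨h.1, fun _ hy => h.2.form_eq_zero hy⟩⟩

theorem TraceZero.eq_sum_differences {x : Space} (hx : TraceZero x) :
    x = ∑ k : Fin 12, x (k.castLE (by decide)) • differences (k.castLE (by decide)) +
      x 16 • differences 12 + x 18 • differences 13 := by
  have d0 : x 0 + x 4 + x 8 + x 12 = 0 := hx.D₄ 0
  have d1 : x 1 + x 5 + x 9 + x 13 = 0 := hx.D₄ 1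
  have d2 : x 2 + x 6 + x 10 + x 14 = 0 := hx.D₄ 2
  have d3 : x 3 + x 7 + x 11 + x 15 = 0 := hx.D₄ 3
  have hA := hx.A₁
  ext k
  simp only [differences, Fin.sum_univ_succ]
  fin_cases k <;>
    simp [e₁, e₂, e₃, e₄, f₁, f₂, f₃, f₄, g₁, g₂, g₃, g₄, h₁, h₂, h₃, h₄, a₁, a₂, σ,
      Fin.ext_iff, hx.ρ, hx.ω₁, hx.ω₂] <;> linarith

/-- The expansion in the basis `mult i • dualVec i` of `Ω₄`, with coordinates given by the pairings
with `coordVec`. -/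
theorem TraceZero.eq_sum {x : Space} (hx : TraceZero x) :
    x = ∑ i, (mult i * form x (coordVec i)) • dualVec i := by
  let T : Space →ₗ[ℚ] Space :=
    ∑ i, ((mult i : ℚ) • form.flip (coordVec i)).smulRight (dualVec i)
  have hT : ∀ y, T y = ∑ i, (mult i * form y (coordVec i)) • dualVec i := fun y => by
    simp [T, LinearMap.sum_apply]
  have hd : ∀ k, T (differences k) = differences k := fun k => by
    ext l
    rw [hT, differences_eq k l]
    simp [Finset.sum_apply]
  rw [← hT]
  conv_rhs => rw [hx.eq_sum_differences]
  simp only [map_add, map_sum, map_smul, hd]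
  exact hx.eq_sum_differences

/-- The linear combination of the vectors `dualVec` with given integral coefficients. -/
def ofCoords : (Fin 14 → ℤ) →ₗ[ℤ] Space := Fintype.linearCombination ℤ dualVec

theorem ofCoords_apply (n : Fin 14 → ℤ) : ofCoords n = ∑ i, n i • dualVec i :=
  Fintype.linearCombination_apply ..

theorem form_zsmul_left (n : ℤ) (x y : Space) : form (n • x) y = n * form x y := by
  rw [map_zsmul, LinearMap.smul_apply, zsmul_eq_mul]

theorem form_zsmul_right (n : ℤ) (x y : Space) : form x (n • y) = n * form x y := by
  rw [map_zsmul, zsmul_eq_mul]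

theorem form_ofCoords (n k : Fin 14 → ℤ) :
    form (ofCoords n) (ofCoords k) = ((n ⬝ᵥ gram.mulVec k : ℤ) : ℚ) / 4 := by
  simp only [ofCoords_apply, map_sum, LinearMap.sum_apply, form_zsmul_left, form_zsmul_right,
    gram_eq, dotProduct, Matrix.mulVec, Finset.mul_sum, Finset.sum_div, Int.cast_sum,
    Int.cast_mul]
  rw [Finset.sum_comm]
  exact Finset.sum_congr rfl fun i _ => Finset.sum_congr rfl fun j _ => by ring

theorem form_ofCoords_mult_smul (n : Fin 14 → ℤ) (j : Fin 14) :
    form (ofCoords n) (mult j • dualVec j) = (Matrix.vecMul n pairing j : ℤ) := by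
  simp only [ofCoords_apply, map_sum, LinearMap.sum_apply, form_zsmul_left, form_zsmul_right,
    gram_eq, Matrix.vecMul, dotProduct, Int.cast_sum, Int.cast_mul, pairing_eq]
  exact Finset.sum_congr rfl fun i _ => by ring

theorem ofCoords_injective : Function.Injective ofCoords := by
  rw [injective_iff_map_eq_zero]
  intro n hn
  have h : Matrix.vecMul n pairing = 0 := by
    ext j
    have := form_ofCoords_mult_smul n j
    rw [hn, map_zero, LinearMap.zero_apply] at this
    exact_mod_cast this.symm
  rw [← Matrix.vecMul_one n, ← pairing_mul_pairingInv, ← Matrix.vecMul_vecMul, h,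
    Matrix.zero_vecMul]

theorem traceZero_ofCoords (n : Fin 14 → ℤ) : TraceZero (ofCoords n) := by
  have h := traceZero_dualVec
  rw [ofCoords_apply]
  constructor
  · intro i
    simp only [Finset.sum_apply, Pi.smul_apply, ← Finset.sum_add_distrib, ← smul_add, (h _).D₄ i,
      smul_zero, Finset.sum_const_zero]
  · simp only [Finset.sum_apply, Pi.smul_apply, ← Finset.sum_add_distrib, ← smul_add, (h _).A₁,
      smul_zero, Finset.sum_const_zero]
  · simp [Finset.sum_apply, (h _).ρ]
  · simp [Finset.sum_apply, (h _).ω₁]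
  · simp [Finset.sum_apply, (h _).ω₂]

theorem mult_smul_dualVec_mem_carrier (i : Fin 14) : mult i • dualVec i ∈ Ω₄.carrier := by
  refine mem_coinvariantLattice.2 ⟨mult_smul_dualVec_mem i, ?_⟩
  have := traceZero_ofCoords (Pi.single i (mult i))
  rwa [ofCoords, Fintype.linearCombination_apply_single] at this

theorem mem_Ω₄_iff {x : Space} : x ∈ Ω₄.carrier ↔ ∃ n, x = ofCoords (mult * n) := by
  constructor
  -- The coordinates are integral because the K3 lattice is an integral lattice.
  · intro hx
    choose n hn using fun i => lattice.integral hx.1 (coordVec_mem i)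
    refine ⟨n, ?_⟩
    rw [(TraceZero.of_mem hx).eq_sum, ofCoords_apply]
    refine Finset.sum_congr rfl fun i _ => ?_
    rw [← Int.cast_smul_eq_zsmul ℚ, Pi.mul_apply, Int.cast_mul, ← hn]
    rfl
  · rintro ⟨n, rfl⟩
    rw [ofCoords_apply]
    refine sum_mem fun i _ => ?_
    rw [Pi.mul_apply, mul_comm, mul_smul]
    exact Submodule.smul_mem _ _ (mult_smul_dualVec_mem_carrier i)

theorem exists_eq_sum_of_mem_ratSpan {x : Space} (hx : x ∈ Ω₄.ratSpan) :
    ∃ c : Fin 14 → ℚ, x = ∑ i, c i • dualVec i := by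
  have : Ω₄.ratSpan ≤ Submodule.span ℚ (Set.range dualVec) := by
    refine Submodule.span_le.2 fun y hy => ?_
    obtain ⟨n, rfl⟩ := mem_Ω₄_iff.1 hy
    rw [ofCoords_apply]
    exact sum_mem fun i _ => zsmul_mem (Submodule.subset_span (Set.mem_range_self i)) _
  obtain ⟨c, hc⟩ := (Submodule.mem_span_range_iff_exists_fun ℚ).1 (this hx)
  exact ⟨c, hc.symm⟩

theorem mem_dual_iff {x : Space} : x ∈ Ω₄.dual ↔ ∃ n, x = ofCoords n := by
  constructor
  · rintro ⟨hx, hx'⟩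
    obtain ⟨c, rfl⟩ := exists_eq_sum_of_mem_ratSpan hx
    choose y hy using fun j => hx' _ (mult_smul_dualVec_mem_carrier j)
    have hy' : Matrix.vecMul c (pairing.map (Int.castRingHom ℚ)) = fun j => (y j : ℚ) := by
      ext j
      rw [← hy]
      change _ = form _ _
      simp only [map_sum, LinearMap.sum_apply, map_smul, LinearMap.smul_apply, form_zsmul_right,
        gram_eq, Matrix.vecMul, dotProduct, Matrix.map_apply, Int.coe_castRingHom, pairing_eq,
        smul_eq_mul]
      exact Finset.sum_congr rfl fun i _ => by ring
    -- Inverting the matrix of pairings recovers the coordinates from the pairings `y`.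
    refine ⟨Matrix.vecMul y pairingInv, ?_⟩
    have hc : c = fun i => ((Matrix.vecMul y pairingInv i : ℤ) : ℚ) := by
      have h1 : pairing.map (Int.castRingHom ℚ) * pairingInv.map (Int.castRingHom ℚ) = 1 := by
        rw [← Matrix.map_mul, pairing_mul_pairingInv]
        simp
      rw [← Matrix.vecMul_one c, ← h1, ← Matrix.vecMul_vecMul, hy']
      ext i
      simp [Matrix.vecMul, dotProduct]
    rw [ofCoords_apply, hc]
    simp only [Int.cast_smul_eq_zsmul]
  · rintro ⟨n, rfl⟩
    have key : ofCoords n ∈ Ω₄.ratSpan := by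
      rw [ofCoords_apply]
      refine sum_mem fun i _ => zsmul_mem ?_ _
      have h : dualVec i = (mult i : ℚ)⁻¹ • mult i • dualVec i := by
        rw [← Int.cast_smul_eq_zsmul ℚ, smul_smul, inv_mul_cancel₀, one_smul]
        revert i
        decide +kernel
      rw [h]
      exact Submodule.smul_mem _ _ (Submodule.subset_span (mult_smul_dualVec_mem_carrier i))
    refine ⟨key, fun s hs => ?_⟩
    obtain ⟨k, rfl⟩ := mem_Ω₄_iff.1 hs
    refine ⟨Matrix.vecMul n pairing ⬝ᵥ k, ?_⟩
    change form _ _ = _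
    conv_lhs => rw [ofCoords_apply (mult * k)]
    rw [map_sum, dotProduct, Int.cast_sum]
    refine Finset.sum_congr rfl fun j _ => ?_
    rw [Int.cast_mul, ← form_ofCoords_mult_smul, Pi.mul_apply, mul_comm, mul_smul, map_zsmul,
      zsmul_eq_mul, mul_comm]

end K3

namespace EvenLattice

/-! ### Invariance of the discriminant form under isometries -/

variable {V : Type*} [AddCommGroup V] [Module ℚ V] (S : EvenLattice V)

/-- A multiple of `x ∈ S ⊗ ℚ` lies in `S`, where the extension of an isometry is known. -/
theorem exists_smul_eq_and_smul_ratExt_eq (φ : S.isometryGroup) (x : S.ratSpan) :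
    ∃ n : ℤ, n ≠ 0 ∧ ∃ s : S.carrier, n • (x : V) = s ∧ n • (S.ratExt φ.1 x : V) = φ.1 s := by
  obtain ⟨n, hn, s, hs⟩ := S.exists_smul_mem x
  refine ⟨n, hn, s, congrArg (fun z : S.ratSpan => (z : V)) hs, ?_⟩
  have h : n • S.ratExt φ.1 x = S.incl (φ.1 s) := by
    rw [← map_zsmul, hs, ratExt_incl]
    rfl
  exact congrArg (fun z : S.ratSpan => (z : V)) h

theorem form_dualMap_self (φ : S.isometryGroup) (x : S.dual) :
    S.form (S.dualMap φ x) (S.dualMap φ x) = S.form x x := by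
  obtain ⟨n, hn, s, h2, h1⟩ := S.exists_smul_eq_and_smul_ratExt_eq φ ⟨x, x.2.1⟩
  have h3 := S.form_ratExt φ ⟨x, x.2.1⟩ s
  rw [← h1, ← h2, map_zsmul, map_zsmul, zsmul_eq_mul, zsmul_eq_mul] at h3
  exact mul_left_cancel₀ (Int.cast_ne_zero.2 hn) h3

theorem discForm_discMap (φ : S.isometryGroup) (r : S.discGroup) :
    S.discForm (S.discMap φ r) = S.discForm r := by
  obtain ⟨x, rfl⟩ := Submodule.Quotient.mk_surjective _ r
  exact congrArg (fun q : ℚ => (q : AddCircle (2 : ℚ))) (S.form_dualMap_self φ x)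

theorem discMap_bijective (φ : S.isometryGroup) : Function.Bijective (S.discMap φ) := by
  refine Function.bijective_iff_has_inverse.2 ⟨S.discMap φ⁻¹, fun r => ?_, fun r => ?_⟩
  · rw [← LinearMap.comp_apply, ← discMap_mul, inv_mul_cancel, discMap_one, LinearMap.id_apply]
  · rw [← LinearMap.comp_apply, ← discMap_mul, mul_inv_cancel, discMap_one, LinearMap.id_apply]

theorem addOrderOf_discMap (φ : S.isometryGroup) (r : S.discGroup) :
    addOrderOf (S.discMap φ r) = addOrderOf r :=
  addOrderOf_injective (S.discMap φ).toAddMonoidHom (S.discMap_bijective φ).1 r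

theorem isometryClass_subset {r : S.discGroup} {k : ℕ} {g : ℚ} (h : r ∈ S.orderSquareClass k g) :
    S.isometryClass r ⊆ S.orderSquareClass k g := by
  rintro _ ⟨φ, rfl⟩
  exact ⟨(S.addOrderOf_discMap φ r).trans h.1, (S.discForm_discMap φ r).trans h.2⟩

/-- The number of `s ∈ A_S` such that `s` and `s + r` both have square zero. Being defined by the
discriminant form, it is constant on the classes of `≈`, but it can separate elements with the
same order and square. -/
noncomputable def isotropicPairs (r : S.discGroup) : ℕ :=
  {s | S.discForm s = 0 ∧ S.discForm (s + r) = 0}.ncard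

theorem isotropicPairs_discMap (φ : S.isometryGroup) (r : S.discGroup) :
    S.isotropicPairs (S.discMap φ r) = S.isotropicPairs r := by
  have h := S.discMap_bijective φ
  rw [isotropicPairs, isotropicPairs,
    ← Set.ncard_image_of_injective {s | S.discForm s = 0 ∧ S.discForm (s + r) = 0} h.1]
  congr 1
  ext s
  obtain ⟨t, rfl⟩ := h.2 s
  rw [Set.mem_ofPred, ← map_add, discForm_discMap, discForm_discMap, h.1.mem_set_image]
  rfl

/-- If a `ℚ`-linear map restricts to an isometry `φ` of `S`, then it computes the action of `φ`
on `A_S`. -/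
theorem discMap_toDisc (φ : S.isometryGroup) (T : V →ₗ[ℚ] V)
    (hT : ∀ s : S.carrier, T s = φ.1 s) {x : V} (hx : x ∈ S.dual) (hTx : T x ∈ S.dual) :
    S.discMap φ (S.toDisc x hx) = S.toDisc (T x) hTx := by
  refine congrArg (Submodule.Quotient.mk (p := S.carrier.submoduleOf S.dual)) (Subtype.ext ?_)
  obtain ⟨n, hn, s, h2, h1⟩ := S.exists_smul_eq_and_smul_ratExt_eq φ ⟨x, hx.1⟩
  rw [← hT, ← h2, map_zsmul, ← Int.cast_smul_eq_zsmul ℚ, ← Int.cast_smul_eq_zsmul ℚ] at h1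
  exact smul_right_injective _ (Int.cast_ne_zero.2 hn) h1

theorem setOf_orderSquareRel {r : S.discGroup} {k : ℕ} {g : ℚ} (h : r ∈ S.orderSquareClass k g) :
    {s | S.orderSquareRel s r} = S.orderSquareClass k g := by
  ext s
  rw [Set.mem_ofPred, orderSquareClass, Set.mem_ofPred, ← h.1, ← h.2]
  rfl

theorem orderSquareClass_one_zero : S.orderSquareClass 1 0 = {0} := by
  ext r
  rw [orderSquareClass, Set.mem_ofPred, Set.mem_singleton_iff, AddMonoid.addOrderOf_eq_one_iff]
  refine ⟨fun h => h.1, ?_⟩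
  rintro rfl
  refine ⟨rfl, ?_⟩
  change ((S.form 0 0 : ℚ) : AddCircle (2 : ℚ)) = _
  simp

end EvenLattice

namespace K3

/-! ### The discriminant group of `Ω₄` in coordinates -/

/-- The composition of the isomorphism `ℤ¹⁴ ≃ Ω₄*` given by `dualVec` with `Ω₄* → A_{Ω₄}`. -/
noncomputable def disc : (Fin 14 → ℤ) →ₗ[ℤ] Ω₄.discGroup :=
  (Ω₄.carrier.submoduleOf Ω₄.dual).mkQ ∘ₗ
    ofCoords.codRestrict Ω₄.dual fun n => mem_dual_iff.2 ⟨n, rfl⟩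

theorem toDisc_ofCoords (n : Fin 14 → ℤ) (hn : ofCoords n ∈ Ω₄.dual) :
    Ω₄.toDisc (ofCoords n) hn = disc n := rfl

theorem disc_surjective : Function.Surjective disc := by
  intro r
  obtain ⟨⟨x, hx⟩, rfl⟩ := Submodule.Quotient.mk_surjective _ r
  obtain ⟨n, rfl⟩ := mem_dual_iff.1 hx
  exact ⟨n, rfl⟩

theorem disc_eq_zero_iff {n : Fin 14 → ℤ} : disc n = 0 ↔ ∀ i, mult i ∣ n i := by
  rw [← toDisc_ofCoords n (mem_dual_iff.2 ⟨n, rfl⟩), EvenLattice.toDisc,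
    Submodule.Quotient.mk_eq_zero]
  change ofCoords n ∈ Ω₄.carrier ↔ _
  constructor
  · intro h i
    obtain ⟨k, hk⟩ := mem_Ω₄_iff.1 h
    exact ⟨k i, congrFun (ofCoords_injective hk) i⟩
  · intro h
    choose k hk using h
    exact mem_Ω₄_iff.2 ⟨k, congrArg ofCoords (funext hk)⟩

theorem disc_eq_disc_iff {n k : Fin 14 → ℤ} : disc n = disc k ↔ ∀ i, mult i ∣ n i - k i := by
  rw [← sub_eq_zero, ← map_sub, disc_eq_zero_iff]
  rfl

theorem discForm_disc (n : Fin 14 → ℤ) : Ω₄.discForm (disc n) =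
    ((((n ⬝ᵥ gram.mulVec n : ℤ) : ℚ) / 4 : ℚ) : AddCircle (2 : ℚ)) := by
  rw [← form_ofCoords]
  rfl

/-- Reduction of the coordinates modulo the elementary divisors. -/
def reduction : (Fin 14 → ℤ) →ₗ[ℤ] (Fin 4 → ZMod 4) × (Fin 2 → ZMod 2) where
  toFun n := (fun i => n (i.castLE (by decide)), fun i => n ((i.natAdd 4).castLE (by decide)))
  map_add' n k := by ext <;> simp
  map_smul' c n := by ext <;> simp

theorem reduction_surjective : Function.Surjective reduction := by
  rintro ⟨a, b⟩
  refine ⟨![(a 0).val, (a 1).val, (a 2).val, (a 3).val, (b 0).val, (b 1).val,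
    0, 0, 0, 0, 0, 0, 0, 0], ?_⟩
  refine Prod.ext (funext fun i => ?_) (funext fun i => ?_)
  · fin_cases i <;> simp [reduction]
  · fin_cases i <;> simp [reduction]

theorem ker_reduction : LinearMap.ker reduction = LinearMap.ker disc := by
  ext n
  rw [LinearMap.mem_ker, LinearMap.mem_ker, disc_eq_zero_iff]
  have h4 : ∀ i, ((n i : ℤ) : ZMod 4) = 0 ↔ 4 ∣ n i := fun i =>
    ZMod.intCast_zmod_eq_zero_iff_dvd _ 4
  have h2 : ∀ i, ((n i : ℤ) : ZMod 2) = 0 ↔ 2 ∣ n i := fun i =>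
    ZMod.intCast_zmod_eq_zero_iff_dvd _ 2
  simp [reduction, Prod.ext_iff, funext_iff, Fin.forall_fin_succ, h4, h2, mult, and_assoc]

/-- Both `disc` and `reduction` present their targets as the quotient of `ℤ¹⁴` by
`{n | ∀ i, mult i ∣ n i}`. -/
noncomputable def discGroupEquiv : Ω₄.discGroup ≃ₗ[ℤ] (Fin 4 → ZMod 4) × (Fin 2 → ZMod 2) :=
  (disc.quotKerEquivOfSurjective disc_surjective).symm ≪≫ₗ
    Submodule.quotEquivOfEq _ _ ker_reduction.symm ≪≫ₗ
      reduction.quotKerEquivOfSurjective reduction_surjective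

/-! ### Numbering the discriminant group -/

/-- The number `c < 1024` encodes the element of `A_{Ω₄}` whose six coordinates are the digits of
`c`, from the lowest to the highest, in the mixed radix `4, 4, 4, 4, 2, 2`. -/
def digits (c : ℕ) : Fin 14 → ℤ :=
  ![(c % 4 : ℕ), (c / 4 % 4 : ℕ), (c / 16 % 4 : ℕ), (c / 64 % 4 : ℕ), (c / 256 % 2 : ℕ),
    (c / 512 % 2 : ℕ), 0, 0, 0, 0, 0, 0, 0, 0]

/-- The number of the element of `A_{Ω₄}` with given coordinates. -/
def number (n : Fin 14 → ℤ) : ℕ :=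
  (n 0 % 4).toNat + 4 * (n 1 % 4).toNat + 16 * (n 2 % 4).toNat + 64 * (n 3 % 4).toNat +
    256 * (n 4 % 2).toNat + 512 * (n 5 % 2).toNat

theorem number_lt (n : Fin 14 → ℤ) : number n < 1024 := by
  unfold number
  omega

theorem mixed_radix_digits {a b c d e f N : ℕ} (ha : a < 4) (hb : b < 4) (hc : c < 4) (hd : d < 4)
    (he : e < 2) (hf : f < 2) (h : N = a + 4 * b + 16 * c + 64 * d + 256 * e + 512 * f) :
    N % 4 = a ∧ N / 4 % 4 = b ∧ N / 16 % 4 = c ∧ N / 64 % 4 = d ∧ N / 256 % 2 = e ∧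
      N / 512 % 2 = f := by
  have h1 : N / 4 = b + 4 * c + 16 * d + 64 * e + 128 * f := by omega
  have h2 : N / 16 = c + 4 * d + 16 * e + 32 * f := by omega
  have h3 : N / 64 = d + 4 * e + 8 * f := by omega
  have h4 : N / 256 = e + 2 * f := by omega
  have h5 : N / 512 = f := by omega
  rw [h1, h2, h3, h4, h5]
  clear h1 h2 h3 h4 h5
  refine ⟨?_, ?_, ?_, ?_, ?_, ?_⟩ <;> omega

theorem disc_digits_number (n : Fin 14 → ℤ) : disc (digits (number n)) = disc n := by
  rw [disc_eq_disc_iff]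
  obtain ⟨e0, e1, e2, e3, e4, e5⟩ : number n % 4 = (n 0 % 4).toNat ∧
      number n / 4 % 4 = (n 1 % 4).toNat ∧ number n / 16 % 4 = (n 2 % 4).toNat ∧
      number n / 64 % 4 = (n 3 % 4).toNat ∧ number n / 256 % 2 = (n 4 % 2).toNat ∧
      number n / 512 % 2 = (n 5 % 2).toNat :=
    mixed_radix_digits (by omega) (by omega) (by omega) (by omega) (by omega) (by omega) rfl
  have h0 : 4 ∣ ((number n % 4 : ℕ) : ℤ) - n 0 := by rw [e0]; omega
  have h1 : 4 ∣ ((number n / 4 % 4 : ℕ) : ℤ) - n 1 := by rw [e1]; omega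
  have h2 : 4 ∣ ((number n / 16 % 4 : ℕ) : ℤ) - n 2 := by rw [e2]; omega
  have h3 : 4 ∣ ((number n / 64 % 4 : ℕ) : ℤ) - n 3 := by rw [e3]; omega
  have h4 : 2 ∣ ((number n / 256 % 2 : ℕ) : ℤ) - n 4 := by rw [e4]; omega
  have h5 : 2 ∣ ((number n / 512 % 2 : ℕ) : ℤ) - n 5 := by rw [e5]; omega
  intro i
  fin_cases i
  exacts [h0, h1, h2, h3, h4, h5, one_dvd _, one_dvd _, one_dvd _, one_dvd _, one_dvd _,
    one_dvd _, one_dvd _, one_dvd _]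

/-- The element of `A_{Ω₄}` with number `c`. -/
noncomputable def element (c : ℕ) : Ω₄.discGroup := disc (digits c)

theorem exists_element (r : Ω₄.discGroup) : ∃ c < 1024, element c = r := by
  obtain ⟨n, rfl⟩ := disc_surjective r
  exact ⟨number n, number_lt n, disc_digits_number n⟩

theorem element_injOn : Set.InjOn element {c | c < 1024} := by
  intro c hc k hk h
  have h := disc_eq_disc_iff.1 h
  have h0 : 4 ∣ ((c % 4 : ℕ) : ℤ) - (k % 4 : ℕ) := h 0
  have h1 : 4 ∣ ((c / 4 % 4 : ℕ) : ℤ) - (k / 4 % 4 : ℕ) := h 1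
  have h2 : 4 ∣ ((c / 16 % 4 : ℕ) : ℤ) - (k / 16 % 4 : ℕ) := h 2
  have h3 : 4 ∣ ((c / 64 % 4 : ℕ) : ℤ) - (k / 64 % 4 : ℕ) := h 3
  have h4 : 2 ∣ ((c / 256 % 2 : ℕ) : ℤ) - (k / 256 % 2 : ℕ) := h 4
  have h5 : 2 ∣ ((c / 512 % 2 : ℕ) : ℤ) - (k / 512 % 2 : ℕ) := h 5
  rw [Set.mem_ofPred] at hc hk
  omega

/-- Counting a subset of `A_{Ω₄}` by means of the numbering. -/
theorem ncard_eq_card_filter {s : Set Ω₄.discGroup} (p : ℕ → Prop) [DecidablePred p]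
    (h : ∀ c < 1024, element c ∈ s ↔ p c) : s.ncard = ((Finset.range 1024).filter p).card := by
  have hs : s = element '' ((Finset.range 1024).filter p) := by
    ext r
    obtain ⟨c, hc, rfl⟩ := exists_element r
    rw [h c hc]
    constructor
    · exact fun hp => ⟨c, by simp [hc, hp], rfl⟩
    · rintro ⟨k, hk, hkc⟩
      simp only [Finset.coe_filter, Finset.mem_range, Set.mem_ofPred] at hk
      rw [← element_injOn hk.1 hc hkc]
      exact hk.2
  rw [hs, Set.InjOn.ncard_image, Set.ncard_coe_finset]
  refine element_injOn.mono fun c hc => ?_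
  simp only [Finset.coe_filter, Finset.mem_range, Set.mem_ofPred] at hc
  exact hc.1

/-- The order of `element c`. -/
def order (c : ℕ) : ℕ :=
  if c = 0 then 1 else
    if c % 2 = 0 ∧ c / 4 % 2 = 0 ∧ c / 16 % 2 = 0 ∧ c / 64 % 2 = 0 then 2 else 4

theorem addOrderOf_element {c : ℕ} (hc : c < 1024) : addOrderOf (element c) = order c := by
  have h0 : element 0 = 0 := disc_eq_zero_iff.2 (by decide +kernel)
  have h4 : 4 • element c = 0 := by
    rw [element, ← map_nsmul, disc_eq_zero_iff]
    intro i
    have : mult i ∣ 4 := by revert i; decide +kernel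
    exact this.trans ⟨digits c i, by simp⟩
  have h2 : 2 • element c = 0 ↔
      c % 2 = 0 ∧ c / 4 % 2 = 0 ∧ c / 16 % 2 = 0 ∧ c / 64 % 2 = 0 := by
    rw [element, ← map_nsmul, disc_eq_zero_iff]
    simp only [Fin.forall_fin_succ, IsEmpty.forall_iff, and_true]
    simp [mult, digits]
    omega
  unfold order
  split_ifs with h h'
  · rw [h, h0, addOrderOf_zero]
  · refine addOrderOf_eq_prime (h2.2 h') fun h'' => h ?_
    exact element_injOn hc (by simp) (h''.trans h0.symm)
  · exact addOrderOf_eq_prime_pow (p := 2) (n := 1) (fun h'' => h' (h2.1 (by simpa using h'')))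
      (by simpa using h4)

/-- Twice the square, modulo `4`, of the element of `A_{Ω₄}` with the given coordinates. -/
def twiceSquare (a b c d e f : ℕ) : ℕ :=
  (a ^ 2 + b ^ 2 + c ^ 2 + d ^ 2 + 2 * e ^ 2 + f ^ 2 + 2 * a * b + a * c + 3 * a * d + 2 * a * e +
    2 * a * f + 2 * b * c + b * d + 2 * b * f + c * d + 2 * c * e + 2 * d * e + 2 * d * f +
    2 * e * f) % 4

/-- The square of an element of `A_{Ω₄}` is `m / 2 + 2ℤ` for an integral quadratic polynomial `m` in
the coordinates, so that it only depends on `m` modulo `4`. -/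
theorem discForm_disc_six (a b c d e f : ℕ) :
    Ω₄.discForm (disc ![a, b, c, d, e, f, 0, 0, 0, 0, 0, 0, 0, 0]) =
      ((twiceSquare a b c d e f / 2 : ℚ) : AddCircle (2 : ℚ)) := by
  rw [discForm_disc, ← sub_eq_zero, ← AddCircle.coe_sub, AddCircle.coe_eq_zero_iff]
  set m := a ^ 2 + b ^ 2 + c ^ 2 + d ^ 2 + 2 * e ^ 2 + f ^ 2 + 2 * a * b + a * c + 3 * a * d +
    2 * a * e + 2 * a * f + 2 * b * c + b * d + 2 * b * f + c * d + 2 * c * e + 2 * d * e +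
    2 * d * f + 2 * e * f with hm
  obtain ⟨t, h⟩ : ∃ t : ℕ, (twiceSquare a b c d e f : ℚ) = m - 4 * t := by
    refine ⟨m / 4, ?_⟩
    have : twiceSquare a b c d e f + 4 * (m / 4) = m := Nat.mod_add_div m 4
    rw [eq_sub_iff_add_eq]
    exact_mod_cast this
  refine ⟨t - (a ^ 2 + b ^ 2 + c ^ 2 + d ^ 2 + e ^ 2 + f ^ 2 + a * c + a * d + a * e +
    a * f + c * d + c * e + d * e + d * f + e * f : ℕ), ?_⟩
  rw [h, hm]
  simp [dotProduct, Matrix.mulVec, Fin.sum_univ_succ, gram]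
  ring

/-- Twice the square of `element c` modulo `4`. -/
def square (c : ℕ) : ℕ :=
  twiceSquare (c % 4) (c / 4 % 4) (c / 16 % 4) (c / 64 % 4) (c / 256 % 2) (c / 512 % 2)

theorem coe_half_eq_coe_half_iff {a b : ℕ} (ha : a < 4) (hb : b < 4) :
    ((a / 2 : ℚ) : AddCircle (2 : ℚ)) = ((b / 2 : ℚ) : AddCircle (2 : ℚ)) ↔ a = b := by
  refine ⟨fun h => ?_, fun h => by rw [h]⟩
  rw [← sub_eq_zero, ← AddCircle.coe_sub, AddCircle.coe_eq_zero_iff] at h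
  obtain ⟨n, hn⟩ := h
  have : (4 * n : ℤ) = a - b := by
    have : (4 * n : ℚ) = a - b := by
      rw [zsmul_eq_mul] at hn
      linarith
    exact_mod_cast this
  omega

theorem element_mem_orderSquareClass {c k h : ℕ} (hc : c < 1024) (hh : h < 4) :
    element c ∈ Ω₄.orderSquareClass k (h / 2) ↔ order c = k ∧ square c = h := by
  rw [EvenLattice.orderSquareClass, Set.mem_ofPred, addOrderOf_element hc, element, digits,
    discForm_disc_six]
  exact and_congr_right' (coe_half_eq_coe_half_iff (Nat.mod_lt _ (by decide)) hh)

theorem discForm_element_eq_zero {c : ℕ} : Ω₄.discForm (element c) = 0 ↔ square c = 0 := by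
  rw [element, digits, discForm_disc_six, ← square]
  have := coe_half_eq_coe_half_iff (a := square c) (b := 0) (Nat.mod_lt _ (by decide)) (by decide)
  simpa using this

/-- Twice the square modulo `4` of the sum of `element c` and `element k`. -/
def squareAdd (c k : ℕ) : ℕ :=
  twiceSquare (c % 4 + k % 4) (c / 4 % 4 + k / 4 % 4) (c / 16 % 4 + k / 16 % 4)
    (c / 64 % 4 + k / 64 % 4) (c / 256 % 2 + k / 256 % 2) (c / 512 % 2 + k / 512 % 2)

theorem discForm_element_add_eq_zero {c k : ℕ} :
    Ω₄.discForm (element c + element k) = 0 ↔ squareAdd c k = 0 := by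
  have h : digits c + digits k = ![((c % 4 + k % 4 : ℕ) : ℤ), (c / 4 % 4 + k / 4 % 4 : ℕ),
      (c / 16 % 4 + k / 16 % 4 : ℕ), (c / 64 % 4 + k / 64 % 4 : ℕ),
      (c / 256 % 2 + k / 256 % 2 : ℕ), (c / 512 % 2 + k / 512 % 2 : ℕ),
      0, 0, 0, 0, 0, 0, 0, 0] := by
    simp [digits]
  rw [element, element, ← map_add, h, discForm_disc_six, ← squareAdd]
  have := coe_half_eq_coe_half_iff (a := squareAdd c k) (b := 0) (Nat.mod_lt _ (by decide))
    (by decide)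
  simpa using this

theorem isotropicPairs_element (k : ℕ) : Ω₄.isotropicPairs (element k) =
    ((Finset.range 1024).filter fun c => square c = 0 ∧ squareAdd c k = 0).card :=
  ncard_eq_card_filter _ fun c _ => by
    rw [Set.mem_ofPred, discForm_element_eq_zero, discForm_element_add_eq_zero]

theorem ncard_orderSquareClass {k h : ℕ} (hh : h < 4) : (Ω₄.orderSquareClass k (h / 2)).ncard =
    ((Finset.range 1024).filter fun c => order c = k ∧ square c = h).card :=
  ncard_eq_card_filter _ fun _ hc => element_mem_orderSquareClass hc hh

/-! ### Isometries of `Ω₄` given by matrices -/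

theorem mult_mul_form_dualVec_coordVec :
    ∀ i j, mult i * form (dualVec j) (coordVec i) = if i = j then 1 else 0 := by
  decide +kernel

/-- `P`, acting on row vectors of coordinates in the basis `dualVec`, is an involutive isometry of
`Ω₄ ⊗ ℚ` that preserves `Ω₄*` and `Ω₄`; the preservation of `Ω₄` is the condition `dvd`. -/
structure IsIsometricInvolution (P : Matrix (Fin 14) (Fin 14) ℤ) : Prop where
  mul_self : P * P = 1
  gram : P * gram * P.transpose = gram
  dvd : ∀ i j, mult j ∣ mult i * P i j

/-- A `ℚ`-linear endomorphism of `Space` that maps `Ω₄ ⊗ ℚ` to itself by the matrix `P`. Its values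
on the rest of `Space` play no role. -/
noncomputable def ofMatrix (P : Matrix (Fin 14) (Fin 14) ℤ) : Space →ₗ[ℚ] Space :=
  ∑ i, ((mult i : ℚ) • form.flip (coordVec i)).smulRight (ofCoords (P i))

theorem ofMatrix_ofCoords (P : Matrix (Fin 14) (Fin 14) ℤ) (n : Fin 14 → ℤ) :
    ofMatrix P (ofCoords n) = ofCoords (Matrix.vecMul n P) := by
  have h : ∀ j, ofMatrix P (dualVec j) = ofCoords (P j) := fun j => by
    simp [ofMatrix, LinearMap.sum_apply, mult_mul_form_dualVec_coordVec]
  rw [Matrix.vecMul_eq_sum, map_sum, ofCoords_apply, map_sum]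
  simp only [map_zsmul, h]

namespace IsIsometricInvolution

variable {P : Matrix (Fin 14) (Fin 14) ℤ} (hP : IsIsometricInvolution P)
include hP

theorem ofMatrix_mem {x : Space} (hx : x ∈ Ω₄.carrier) : ofMatrix P x ∈ Ω₄.carrier := by
  obtain ⟨n, rfl⟩ := mem_Ω₄_iff.1 hx
  choose Q hQ using hP.dvd
  rw [ofMatrix_ofCoords]
  refine mem_Ω₄_iff.2 ⟨Matrix.vecMul n (Matrix.of Q), congrArg ofCoords (funext fun j => ?_)⟩
  simp only [Matrix.vecMul, dotProduct, Pi.mul_apply, Matrix.of_apply, Finset.mul_sum]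
  refine Finset.sum_congr rfl fun i _ => ?_
  rw [mul_right_comm, hQ]
  ring

theorem ofMatrix_ofMatrix {x : Space} (hx : x ∈ Ω₄.carrier) :
    ofMatrix P (ofMatrix P x) = x := by
  obtain ⟨n, rfl⟩ := mem_Ω₄_iff.1 hx
  rw [ofMatrix_ofCoords, ofMatrix_ofCoords, Matrix.vecMul_vecMul, hP.mul_self, Matrix.vecMul_one]

theorem form_ofMatrix {x y : Space} (hx : x ∈ Ω₄.carrier) (hy : y ∈ Ω₄.carrier) :
    form (ofMatrix P x) (ofMatrix P y) = form x y := by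
  obtain ⟨n, rfl⟩ := mem_Ω₄_iff.1 hx
  obtain ⟨k, rfl⟩ := mem_Ω₄_iff.1 hy
  rw [ofMatrix_ofCoords, ofMatrix_ofCoords, form_ofCoords, form_ofCoords,
    ← Matrix.mulVec_transpose P (mult * k), Matrix.mulVec_mulVec, ← Matrix.dotProduct_mulVec,
    Matrix.mulVec_mulVec, ← mul_assoc, hP.gram]

/-- The isometry of `Ω₄` with matrix `P`. -/
noncomputable def isometry : Ω₄.isometryGroup :=
  ⟨LinearEquiv.ofInvolutive (((ofMatrix P).restrictScalars ℤ).restrict fun _ => hP.ofMatrix_mem)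
    fun x => Subtype.ext (hP.ofMatrix_ofMatrix x.2), fun x y => hP.form_ofMatrix x.2 y.2⟩

theorem discMap_disc (n : Fin 14 → ℤ) :
    Ω₄.discMap hP.isometry (disc n) = disc (Matrix.vecMul n P) := by
  have h := mem_dual_iff.2 ⟨Matrix.vecMul n P, ofMatrix_ofCoords P n⟩
  rw [← toDisc_ofCoords n (mem_dual_iff.2 ⟨n, rfl⟩),
    Ω₄.discMap_toDisc hP.isometry (ofMatrix P) (fun _ => rfl) _ h]
  simp only [ofMatrix_ofCoords]
  rfl

end IsIsometricInvolution

/-- Three involutive isometries of `Ω₄`. The group that they generate acts on `A_{Ω₄}` with the same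
orbits as `O(Ω₄)`. -/
def involution : Fin 3 → Matrix (Fin 14) (Fin 14) ℤ :=
  ![!![-1, 1, 2, -2, -1, 1, 0, 0, -1, 0, 0, 0, 0, 0;
          0, -3, -2, 0, 0, 0, 0, -1, 0, 0, 0, 1, 1, -1;
          0, 0, 1, 0, 0, 0, 0, 0, 0, 0, 0, 0, 0, 0;
          0, -2, -1, 1, -1, 0, 0, 0, 0, 0, 0, 1, 1, -1;
          0, 0, 2, 0, -1, 0, 0, 0, 0, 0, -1, 0, 0, 0;
          0, 0, 2, 0, -2, 1, 0, 0, 0, 0, -1, 0, 0, 0;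
          0, 4, 4, 0, 0, 0, 1, 0, 0, 0, -1, -2, -2, 2;
          0, 4, 4, 0, 0, 0, 0, 1, 0, 0, -1, -2, -2, 2;
          0, 0, 0, 0, 2, 0, 0, -1, 1, 0, 0, -1, -1, 1;
          0, 0, 0, 4, 0, -2, 1, 1, 0, -1, 0, 0, -1, 0;
          0, 0, 0, 0, 0, 0, 0, 0, 0, 0, 1, 0, 0, 0;
          0, -4, 0, 4, 0, 0, 0, -1, 2, 0, -2, 0, 0, -1;
          0, 0, 0, 0, 0, 0, 0, 0, 0, 0, 0, 0, 1, 0;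
          0, 0, 0, 4, 0, 0, 0, 1, 2, 0, -1, -1, 0, 0],
    !![0, 1, 2, 0, 0, 0, 0, 0, 0, 0, 0, 0, -1, 0;
          1, -2, -2, 2, 0, 0, 0, 0, 1, 0, 0, 1, 1, -1;
          0, 1, 1, -1, -1, 0, 0, 0, -1, 0, 0, 0, 0, 0;
          1, 1, -2, -1, 0, 0, 0, 0, 0, 1, 1, 0, 1, 0;
          0, -2, 0, 2, -1, 0, 1, -1, 0, 0, 0, 1, 0, -1;
          -2, -2, 0, 0, 0, 1, 0, -1, 0, 0, 0, 0, 0, -1;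
          -4, -4, 4, 4, 0, 0, 1, -1, 0, -2, -2, 0, -2, -1;
          -4, 0, 4, 0, 0, 0, 1, -1, -1, -1, -1, -2, -2, 1;
          0, 0, 0, 0, 0, 0, -1, 1, 0, -1, -1, 0, 0, 0;
          0, 0, 0, 0, 0, 0, 1, -1, 0, 1, 0, -1, 0, 1;
          0, 4, 0, -4, 0, 0, -1, 1, -2, 0, 1, -1, 0, 1;
          0, -4, -4, 0, 0, 0, 0, -1, 0, 0, 0, 1, 2, -1;
          0, 0, 0, 0, -2, 0, 0, 0, -1, 0, 0, 1, 1, -1;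
          0, 0, -4, -4, 0, 0, -1, 0, -1, 1, 1, 0, 2, 0],
    !![0, 0, 1, 0, 0, 0, 0, 0, 0, 0, 0, 0, -1, 0;
          0, 1, 0, 0, 0, 0, 0, 0, 0, 0, 0, 0, 0, 0;
          1, 0, 0, 0, 0, 0, 0, 0, 1, 1, 0, 0, 0, 0;
          0, 0, 0, 1, -1, 0, 1, 0, 0, 0, 0, 0, 0, 0;
          0, 0, 0, 0, -1, 0, 0, 0, 0, 0, 0, 0, 0, 0;
          0, 0, 0, 0, -1, 1, 0, 0, 0, 0, 0, 0, 0, 0;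
          0, 0, 0, 0, 0, 0, -1, 0, 0, 0, 0, 0, 0, 0;
          0, 0, 0, 0, 0, 0, 0, 0, 0, 0, 0, -1, 0, 1;
          0, 0, 0, 0, 2, 0, -1, 0, 1, 0, 0, 0, 0, 0;
          0, 0, 0, 0, -2, 0, 1, 0, -1, 0, 0, 0, 1, 0;
          4, 0, 0, 0, 0, 0, 0, 0, 2, 2, 0, 1, 0, 0;
          0, 0, -4, 0, 0, 0, 0, 0, 0, 0, 1, 0, 2, 0;
          0, 0, 0, 0, 0, 0, 0, 0, 1, 1, 0, 0, 0, 0;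
          0, 0, -4, 0, 0, 0, 0, 1, 0, 0, 1, 0, 2, 0]]

theorem isIsometricInvolution_involution (i : Fin 3) : IsIsometricInvolution (involution i) :=
  ⟨by revert i; decide +kernel, by revert i; decide +kernel, by revert i; decide +kernel⟩

/-! ### Orbits -/

/-- The action of a matrix on the numbers of the elements of `A_{Ω₄}`. -/
def act (P : Matrix (Fin 14) (Fin 14) ℤ) (c : ℕ) : ℕ :=
  number fun j => (c % 4 : ℕ) * P 0 j + (c / 4 % 4 : ℕ) * P 1 j + (c / 16 % 4 : ℕ) * P 2 j +
    (c / 64 % 4 : ℕ) * P 3 j + (c / 256 % 2 : ℕ) * P 4 j + (c / 512 % 2 : ℕ) * P 5 j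

theorem act_eq (P : Matrix (Fin 14) (Fin 14) ℤ) (c : ℕ) :
    act P c = number (Matrix.vecMul (digits c) P) := by
  refine congrArg number (funext fun j => ?_)
  simp [Matrix.vecMul, dotProduct, Fin.sum_univ_succ, digits]
  ring

theorem isometryRel_act (i : Fin 3) (c : ℕ) :
    Ω₄.isometryRel (element c) (element (act (involution i) c)) := by
  refine ⟨(isIsometricInvolution_involution i).isometry, ?_⟩
  rw [element, IsIsometricInvolution.discMap_disc, act_eq, element, disc_digits_number]

/-- Search for the orbits of the numbers in the list `todo` under the three involutions: the result
is the set of the numbers visited until the list is exhausted or `fuel` steps are made. Sets of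
numbers are encoded as bit masks. -/
def search : (fuel : ℕ) → (todo : List ℕ) → (seen : ℕ) → ℕ
  | 0, _, seen => seen
  | _ + 1, [], seen => seen
  | fuel + 1, c :: todo, seen =>
    if seen.testBit c then search fuel todo seen
    else search fuel (act (involution 0) c :: act (involution 1) c :: act (involution 2) c :: todo)
      (seen ||| 2 ^ c)

theorem isometryRel_of_search {r : Ω₄.discGroup} (fuel : ℕ) (todo : List ℕ) (seen : ℕ)
    (hr : ∀ c ∈ todo, Ω₄.isometryRel r (element c))
    (hseen : ∀ c, seen.testBit c → Ω₄.isometryRel r (element c)) (c : ℕ)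
    (hc : (search fuel todo seen).testBit c) : Ω₄.isometryRel r (element c) := by
  induction fuel generalizing todo seen with
  | zero => exact hseen c hc
  | succ fuel ih =>
    cases todo with
    | nil => exact hseen c hc
    | cons d todo =>
      rw [search] at hc
      have hd := hr d (by simp)
      have ht : ∀ c ∈ todo, Ω₄.isometryRel r (element c) := fun c h => hr c (by simp [h])
      split_ifs at hc
      · exact ih todo seen ht hseen hc
      · refine ih _ _ ?_ ?_ hc
        · have hi := fun i => Ω₄.isometryRel.trans hd (isometryRel_act i d)
          simpa [hi] using ht
        · intro e he
          rw [Nat.testBit_or, Bool.or_eq_true, Nat.testBit_two_pow] at he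
          rcases he with he | he
          · exact hseen e he
          · rwa [← of_decide_eq_true he]

/-- The numbers of the elements in the orbit of `element c` under the three involutions, as a
bit mask. These orbits have at most `240` elements, each of which puts three numbers on the list, so
that `1 + 3 * 240` steps exhaust it. -/
def orbit (c : ℕ) : ℕ := search 1000 [c] 0

theorem isometryRel_of_testBit_orbit {c d : ℕ} (h : (orbit c).testBit d) :
    Ω₄.isometryRel (element c) (element d) :=
  isometryRel_of_search 1000 [c] 0 (by simp) (by simp) d h

/-! ### The classes of the two relations -/

/-- The search from the representatives exhausts the classes of `∼`; for `(2, 1)` both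
representatives are needed. -/
theorem mem_orbit : ∀ c < 1024,
    (order c = 2 ∧ square c = 0 → (orbit 160).testBit c) ∧
    (order c = 2 ∧ square c = 1 → (orbit 650).testBit c) ∧
    (order c = 2 ∧ square c = 2 → (orbit 392).testBit c ∨ (orbit 296).testBit c) ∧
    (order c = 4 ∧ square c = 0 → (orbit 1016).testBit c) ∧
    (order c = 4 ∧ square c = 1 → (orbit 315).testBit c) ∧
    (order c = 4 ∧ square c = 2 → (orbit 479).testBit c) ∧
    (order c = 4 ∧ square c = 3 → (orbit 603).testBit c) := by
  decide +kernel

theorem isometryClass_element_eq {b k h : ℕ} (hb : b < 1024) (hh : h < 4)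
    (hbk : order b = k ∧ square b = h)
    (H : ∀ c < 1024, order c = k ∧ square c = h → (orbit b).testBit c) :
    Ω₄.isometryClass (element b) = Ω₄.orderSquareClass k (h / 2) := by
  refine (Ω₄.isometryClass_subset ((element_mem_orderSquareClass hb hh).2 hbk)).antisymm
    fun r hr => ?_
  obtain ⟨c, hc, rfl⟩ := exists_element r
  exact isometryRel_of_testBit_orbit (H c hc ((element_mem_orderSquareClass hc hh).1 hr))

/-- The number `b` of the class of a vector with integral coordinates `n` in the basis `dualVec`. -/
theorem exists_toDisc_eq_element {x : Space} (n : Fin 14 → ℤ) (b : ℕ)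
    (hx : ∀ l, x l = ∑ i, n i * dualVec i l) (hb : ∀ i, mult i ∣ n i - digits b i) :
    ∃ h : x ∈ Ω₄.dual, Ω₄.toDisc x h = element b := by
  have h : x = ofCoords n := by
    ext l
    rw [hx, ofCoords_apply, Finset.sum_apply]
    simp
  subst h
  exact ⟨mem_dual_iff.2 ⟨n, rfl⟩, disc_eq_disc_iff.2 hb⟩

theorem x_two_zero_eq : ∃ h : x_two_zero ∈ Ω₄.dual, Ω₄.toDisc x_two_zero h = element 160 :=
  exists_toDisc_eq_element ![4, 4, 2, -6, 0, 0, -2, 0, 0, 2, 0, 0, 0, 2] 160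
    (by decide +kernel) (by decide +kernel)

theorem x_two_half_eq : ∃ h : x_two_half ∈ Ω₄.dual, Ω₄.toDisc x_two_half h = element 650 :=
  exists_toDisc_eq_element ![-6, -6, -4, 6, 0, -1, 3, -1, -2, -3, 1, 1, 1, -3] 650
    (by decide +kernel) (by decide +kernel)

theorem x_two_one_six_eq :
    ∃ h : x_two_one_six ∈ Ω₄.dual, Ω₄.toDisc x_two_one_six h = element 392 :=
  exists_toDisc_eq_element ![0, -2, 0, 2, -1, 0, 1, -1, 0, 0, 0, 1, 0, -1] 392
    (by decide +kernel) (by decide +kernel)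

theorem x_two_one_ten_eq :
    ∃ h : x_two_one_ten ∈ Ω₄.dual, Ω₄.toDisc x_two_one_ten h = element 296 :=
  exists_toDisc_eq_element ![4, 2, 2, -4, -1, 0, -1, -1, 0, 2, 0, 1, 0, 1] 296
    (by decide +kernel) (by decide +kernel)

theorem x_four_zero_eq : ∃ h : x_four_zero ∈ Ω₄.dual, Ω₄.toDisc x_four_zero h = element 1016 :=
  exists_toDisc_eq_element ![0, 2, -1, -5, 1, -1, -1, 0, -2, 0, 1, 0, 1, 1] 1016
    (by decide +kernel) (by decide +kernel)

theorem x_four_half_eq : ∃ h : x_four_half ∈ Ω₄.dual, Ω₄.toDisc x_four_half h = element 315 :=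
  exists_toDisc_eq_element ![-9, -6, -9, 0, 3, 0, 0, 0, -3, -3, 3, 0, 3, -3] 315
    (by decide +kernel) (by decide +kernel)

theorem x_four_one_eq : ∃ h : x_four_one ∈ Ω₄.dual, Ω₄.toDisc x_four_one h = element 479 :=
  exists_toDisc_eq_element ![-17, -17, -7, 7, -1, 0, 5, -4, -6, -7, 2, 3, 2, -7] 479
    (by decide +kernel) (by decide +kernel)

theorem x_four_three_halves_eq :
    ∃ h : x_four_three_halves ∈ Ω₄.dual, Ω₄.toDisc x_four_three_halves h = element 603 :=
  exists_toDisc_eq_element ![-1, -2, -3, 1, 0, -1, 1, 0, -1, -1, 1, 1, 1, -1] 603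
    (by decide +kernel) (by decide +kernel)

/-- The pairs formed by the order of an element of `A_{Ω₄}` and twice its square modulo `4`. -/
def invariantPairs : Finset (ℕ × ℕ) :=
  {(1, 0), (2, 0), (2, 1), (2, 2), (4, 0), (4, 1), (4, 2), (4, 3)}

theorem image_invariants :
    (Finset.range 1024).image (fun c => (order c, square c)) = invariantPairs := by
  decide +kernel

theorem classes_orderSquareRel : Ω₄.orderSquareRel.classes =
    (fun p : ℕ × ℕ => Ω₄.orderSquareClass p.1 (p.2 / 2)) '' invariantPairs := by
  have hsq : ∀ c, square c < 4 := fun c => Nat.mod_lt _ (by decide)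
  ext X
  rw [← image_invariants]
  constructor
  · rintro ⟨r, rfl⟩
    obtain ⟨c, hc, rfl⟩ := exists_element r
    refine ⟨(order c, square c), ?_, (Ω₄.setOf_orderSquareRel
      ((element_mem_orderSquareClass hc (hsq c)).2 ⟨rfl, rfl⟩)).symm⟩
    exact Finset.mem_coe.2 (Finset.mem_image_of_mem _ (Finset.mem_range.2 hc))
  · rintro ⟨p, hp, rfl⟩
    obtain ⟨c, hc, rfl⟩ := Finset.mem_image.1 (Finset.mem_coe.1 hp)
    exact ⟨element c, (Ω₄.setOf_orderSquareRel
      ((element_mem_orderSquareClass (Finset.mem_range.1 hc) (hsq c)).2 ⟨rfl, rfl⟩)).symm⟩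

theorem ncard_classes_orderSquareRel : Ω₄.orderSquareRel.classes.ncard = 8 := by
  rw [classes_orderSquareRel, Set.InjOn.ncard_image, Set.ncard_coe_finset]
  · rfl
  · intro p hp q hq h
    have hlt : ∀ p ∈ invariantPairs, p.2 < 4 := by decide
    have hq4 := hlt q hq
    rw [← image_invariants] at hp
    obtain ⟨c, hc, rfl⟩ := Finset.mem_image.1 (Finset.mem_coe.1 hp)
    have hc := Finset.mem_range.1 hc
    have hmem : element c ∈ Ω₄.orderSquareClass (order c) (square c / 2) :=
      (element_mem_orderSquareClass hc (Nat.mod_lt _ (by decide))).2 ⟨rfl, rfl⟩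
    simp only at h
    rw [h, element_mem_orderSquareClass hc hq4] at hmem
    exact Prod.ext hmem.1 hmem.2

theorem isotropicPairs_six : Ω₄.isotropicPairs (element 392) = 160 := by
  rw [isotropicPairs_element]
  decide +kernel

theorem isotropicPairs_ten : Ω₄.isotropicPairs (element 296) = 96 := by
  rw [isotropicPairs_element]
  decide +kernel

theorem disjoint_isometryClass :
    Disjoint (Ω₄.isometryClass (element 392)) (Ω₄.isometryClass (element 296)) := by
  rw [Set.disjoint_left]
  rintro r ⟨φ, rfl⟩ ⟨ψ, h⟩
  have := congrArg Ω₄.isotropicPairs h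
  rw [Ω₄.isotropicPairs_discMap, Ω₄.isotropicPairs_discMap, isotropicPairs_six,
    isotropicPairs_ten] at this
  exact absurd this (by decide)

theorem element_mem_orderSquareClass_two_one {c : ℕ} (hc : c < 1024) :
    element c ∈ Ω₄.orderSquareClass 2 1 ↔ order c = 2 ∧ square c = 2 := by
  have := element_mem_orderSquareClass (c := c) (k := 2) (h := 2) hc (by decide)
  rwa [Nat.cast_ofNat, div_self two_ne_zero] at this

theorem union_isometryClass :
    Ω₄.isometryClass (element 392) ∪ Ω₄.isometryClass (element 296) =
      Ω₄.orderSquareClass 2 1 := by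
  refine (Set.union_subset ?_ ?_).antisymm fun r hr => ?_
  · exact Ω₄.isometryClass_subset ((element_mem_orderSquareClass_two_one (by decide)).2 (by decide))
  · exact Ω₄.isometryClass_subset ((element_mem_orderSquareClass_two_one (by decide)).2 (by decide))
  · obtain ⟨c, hc, rfl⟩ := exists_element r
    exact ((mem_orbit c hc).2.2.1 ((element_mem_orderSquareClass_two_one hc).1 hr)).imp
      isometryRel_of_testBit_orbit isometryRel_of_testBit_orbit

/-- If two disjoint classes for `≈` make up `(2, 1)` and the searches from their representatives
exhaust it, then each search finds exactly its own class. -/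
theorem ncard_isometryClass_of_disjoint {a b : ℕ} (hab : Disjoint (Ω₄.isometryClass (element a))
      (Ω₄.isometryClass (element b)))
    (hU : Ω₄.isometryClass (element a) ∪ Ω₄.isometryClass (element b) =
      Ω₄.orderSquareClass 2 1)
    (H : ∀ c < 1024, order c = 2 ∧ square c = 2 → (orbit a).testBit c ∨ (orbit b).testBit c) :
    (Ω₄.isometryClass (element a)).ncard =
      ((Finset.range 1024).filter fun c => (orbit a).testBit c).card := by
  refine ncard_eq_card_filter _ fun c hc => ⟨fun h => ?_, isometryRel_of_testBit_orbit⟩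
  have hc' := hU ▸ Set.mem_union_left (Ω₄.isometryClass (element b)) h
  refine (H c hc ((element_mem_orderSquareClass_two_one hc).1 hc')).resolve_right fun hb => ?_
  exact Set.disjoint_left.1 hab h (isometryRel_of_testBit_orbit hb)

theorem ncard_isometryClass_six : (Ω₄.isometryClass (element 392)).ncard = 6 := by
  rw [ncard_isometryClass_of_disjoint disjoint_isometryClass union_isometryClass
    fun c hc => (mem_orbit c hc).2.2.1]
  decide +kernel

theorem ncard_isometryClass_ten : (Ω₄.isometryClass (element 296)).ncard = 10 := by
  rw [ncard_isometryClass_of_disjoint disjoint_isometryClass.symm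
    (by rw [Set.union_comm, union_isometryClass]) fun c hc h => ((mem_orbit c hc).2.2.1 h).symm]
  decide +kernel

end K3

theorem mainTheorem10 :
    -- the discriminant group
    Nonempty (K3.Ω₄.discGroup ≃+ (Fin 4 → ZMod 4) × (Fin 2 → ZMod 2)) ∧
    -- the classes of `∼`: the trivial one and seven others
    K3.Ω₄.orderSquareRel.classes =
      {{0}, K3.Ω₄.orderSquareClass 2 0, K3.Ω₄.orderSquareClass 2 (1 / 2),
        K3.Ω₄.orderSquareClass 2 1, K3.Ω₄.orderSquareClass 4 0,
        K3.Ω₄.orderSquareClass 4 (1 / 2), K3.Ω₄.orderSquareClass 4 1,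
        K3.Ω₄.orderSquareClass 4 (3 / 2)} ∧
    K3.Ω₄.orderSquareRel.classes.ncard = 8 ∧
    -- the table of cardinalities
    (K3.Ω₄.orderSquareClass 2 0).ncard = 15 ∧
    (K3.Ω₄.orderSquareClass 2 (1 / 2)).ncard = 32 ∧
    (K3.Ω₄.orderSquareClass 2 1).ncard = 16 ∧
    (K3.Ω₄.orderSquareClass 2 (3 / 2)) = ∅ ∧
    (K3.Ω₄.orderSquareClass 4 0).ncard = 240 ∧
    (K3.Ω₄.orderSquareClass 4 (1 / 2)).ncard = 240 ∧
    (K3.Ω₄.orderSquareClass 4 1).ncard = 240 ∧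
    (K3.Ω₄.orderSquareClass 4 (3 / 2)).ncard = 240 ∧
    -- six classes are single classes of `≈`, with the given representatives
    (∃ hx : K3.x_two_zero ∈ K3.Ω₄.dual,
      K3.Ω₄.isometryClass (K3.Ω₄.toDisc K3.x_two_zero hx) = K3.Ω₄.orderSquareClass 2 0) ∧
    (∃ hx : K3.x_two_half ∈ K3.Ω₄.dual,
      K3.Ω₄.isometryClass (K3.Ω₄.toDisc K3.x_two_half hx) =
        K3.Ω₄.orderSquareClass 2 (1 / 2)) ∧
    (∃ hx : K3.x_four_zero ∈ K3.Ω₄.dual,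
      K3.Ω₄.isometryClass (K3.Ω₄.toDisc K3.x_four_zero hx) = K3.Ω₄.orderSquareClass 4 0) ∧
    (∃ hx : K3.x_four_half ∈ K3.Ω₄.dual,
      K3.Ω₄.isometryClass (K3.Ω₄.toDisc K3.x_four_half hx) =
        K3.Ω₄.orderSquareClass 4 (1 / 2)) ∧
    (∃ hx : K3.x_four_one ∈ K3.Ω₄.dual,
      K3.Ω₄.isometryClass (K3.Ω₄.toDisc K3.x_four_one hx) = K3.Ω₄.orderSquareClass 4 1) ∧
    (∃ hx : K3.x_four_three_halves ∈ K3.Ω₄.dual,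
      K3.Ω₄.isometryClass (K3.Ω₄.toDisc K3.x_four_three_halves hx) =
        K3.Ω₄.orderSquareClass 4 (3 / 2)) ∧
    -- the class `(2, 1)` is the disjoint union of two classes of `≈`, with 6 and 10 elements
    (∃ (h₆ : K3.x_two_one_six ∈ K3.Ω₄.dual) (h₁₀ : K3.x_two_one_ten ∈ K3.Ω₄.dual),
      (K3.Ω₄.isometryClass (K3.Ω₄.toDisc K3.x_two_one_six h₆)).ncard = 6 ∧
      (K3.Ω₄.isometryClass (K3.Ω₄.toDisc K3.x_two_one_ten h₁₀)).ncard = 10 ∧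
      Disjoint (K3.Ω₄.isometryClass (K3.Ω₄.toDisc K3.x_two_one_six h₆))
        (K3.Ω₄.isometryClass (K3.Ω₄.toDisc K3.x_two_one_ten h₁₀)) ∧
      K3.Ω₄.isometryClass (K3.Ω₄.toDisc K3.x_two_one_six h₆) ∪
        K3.Ω₄.isometryClass (K3.Ω₄.toDisc K3.x_two_one_ten h₁₀) =
          K3.Ω₄.orderSquareClass 2 1) := by
  -- The numbering records twice the square, a natural number below `4`.
  have half : ∀ (k : ℕ), (K3.Ω₄.orderSquareClass k ((0 : ℕ) / 2) = K3.Ω₄.orderSquareClass k 0 ∧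
      K3.Ω₄.orderSquareClass k ((1 : ℕ) / 2) = K3.Ω₄.orderSquareClass k (1 / 2) ∧
      K3.Ω₄.orderSquareClass k ((2 : ℕ) / 2) = K3.Ω₄.orderSquareClass k 1 ∧
      K3.Ω₄.orderSquareClass k ((3 : ℕ) / 2) = K3.Ω₄.orderSquareClass k (3 / 2)) := fun k => by
    norm_num
  refine ⟨⟨K3.discGroupEquiv.toAddEquiv⟩, ?_, K3.ncard_classes_orderSquareRel, ?_, ?_, ?_, ?_, ?_,
    ?_, ?_, ?_, ?_, ?_, ?_, ?_, ?_, ?_, ?_⟩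
  · rw [K3.classes_orderSquareRel, ← K3.Ω₄.orderSquareClass_one_zero]
    simp [K3.invariantPairs, Set.image_insert_eq]
  · rw [← (half 2).1, K3.ncard_orderSquareClass (by decide)]
    decide +kernel
  · rw [← (half 2).2.1, K3.ncard_orderSquareClass (by decide)]
    decide +kernel
  · rw [← (half 2).2.2.1, K3.ncard_orderSquareClass (by decide)]
    decide +kernel
  · rw [← (half 2).2.2.2, Set.eq_empty_iff_forall_notMem]
    intro r hr
    obtain ⟨c, hc, rfl⟩ := K3.exists_element r
    have hc' := (K3.element_mem_orderSquareClass hc (by decide)).1 hr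
    have : ∀ p ∈ K3.invariantPairs, p ≠ (2, 3) := by decide
    refine this (K3.order c, K3.square c) ?_ (Prod.ext hc'.1 hc'.2)
    rw [← K3.image_invariants]
    exact Finset.mem_image_of_mem _ (Finset.mem_range.2 hc)
  · rw [← (half 4).1, K3.ncard_orderSquareClass (by decide)]
    decide +kernel
  · rw [← (half 4).2.1, K3.ncard_orderSquareClass (by decide)]
    decide +kernel
  · rw [← (half 4).2.2.1, K3.ncard_orderSquareClass (by decide)]
    decide +kernel
  · rw [← (half 4).2.2.2, K3.ncard_orderSquareClass (by decide)]
    decide +kernel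
  · obtain ⟨hx, h⟩ := K3.x_two_zero_eq
    refine ⟨hx, ?_⟩
    rw [h, ← (half 2).1]
    exact K3.isometryClass_element_eq (by decide) (by decide) (by decide)
      fun c hc => (K3.mem_orbit c hc).1
  · obtain ⟨hx, h⟩ := K3.x_two_half_eq
    refine ⟨hx, ?_⟩
    rw [h, ← (half 2).2.1]
    exact K3.isometryClass_element_eq (by decide) (by decide) (by decide)
      fun c hc => (K3.mem_orbit c hc).2.1
  · obtain ⟨hx, h⟩ := K3.x_four_zero_eq
    refine ⟨hx, ?_⟩
    rw [h, ← (half 4).1]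
    exact K3.isometryClass_element_eq (by decide) (by decide) (by decide)
      fun c hc => (K3.mem_orbit c hc).2.2.2.1
  · obtain ⟨hx, h⟩ := K3.x_four_half_eq
    refine ⟨hx, ?_⟩
    rw [h, ← (half 4).2.1]
    exact K3.isometryClass_element_eq (by decide) (by decide) (by decide)
      fun c hc => (K3.mem_orbit c hc).2.2.2.2.1
  · obtain ⟨hx, h⟩ := K3.x_four_one_eq
    refine ⟨hx, ?_⟩
    rw [h, ← (half 4).2.2.1]
    exact K3.isometryClass_element_eq (by decide) (by decide) (by decide)
      fun c hc => (K3.mem_orbit c hc).2.2.2.2.2.1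
  · obtain ⟨hx, h⟩ := K3.x_four_three_halves_eq
    refine ⟨hx, ?_⟩
    rw [h, ← (half 4).2.2.2]
    exact K3.isometryClass_element_eq (by decide) (by decide) (by decide)
      fun c hc => (K3.mem_orbit c hc).2.2.2.2.2.2
  · obtain ⟨h₆, e₆⟩ := K3.x_two_one_six_eq
    obtain ⟨h₁₀, e₁₀⟩ := K3.x_two_one_ten_eq
    refine ⟨h₆, h₁₀, ?_⟩
    rw [e₆, e₁₀]
    exact ⟨K3.ncard_isometryClass_six, K3.ncard_isometryClass_ten, K3.disjoint_isometryClass,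
      K3.union_isometryClass⟩
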